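/- For $\varepsilon>0$ let \[ E=E(\varepsilon)=\{z\in\mathbb C : |\operatorname{Re}(z)-k|<\varepsilon \text{ for some } k\in\mathbb Z\} \] be the pyjama stripe, and for a unit complex number $\theta$ let $E_\theta=\theta^{-1}E$ be the stripe rotated about the origin by $\theta^{-1}$. Put \[ \theta_5=\frac{1+2i}{1-2i},\qquad \theta_{13}=\frac{2+3i}{2-3i},\qquad \Theta_N=\{\theta_5^{\,r}\theta_{13}^{\,s} : r,s\in\mathbb Z,\ 0\le r,s\le N\}\quad(N\ge 0). \] **Theorem.** For every integer $n\ge1$ there exist unit complex numbers $\zeta_1,\zeta_2,\zeta_3$ with $n(\zeta_1+\zeta_2)=\zeta_3$. Moreover, for every $\varepsilon>0$ the following hold. 1. There are integers $n\ge 1$ and $N\ge 0$, depending only on $\varepsilon$, such that for every triple of unit complex numbers $\zeta_1,\zeta_2,\zeta_3$ with $n(\zeta_1+\zeta_2)=\zeta_3$, the set $\Theta'=\zeta_1\Theta_N\cup\zeta_2\Theta_N\cup\zeta_3\Theta_N$ satisfies \[ \bigcup_{\theta\in\Theta'}E_\theta=\mathbb C. \] 2. In particular, there is a finite set $\Phi$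 of unit complex numbers such that $\bigcup_{\phi\in\Phi}E_\phi=\mathbb C$; that is, finitely many rotations of the pyjama stripe $E(\varepsilon)$ cover the plane. -/

import Mathlib

noncomputable section

namespace Pyjama

/-- The pyjama stripe: the complex numbers whose real part lies within distance
(strictly) less than `ε` of an integer, i.e. `Re z (mod 1) ∈ (-ε, ε)`. -/
def stripe (ε : ℝ) : Set ℂ :=
  {z : ℂ | ∃ k : ℤ, |z.re - (k : ℝ)| < ε}

/-- The rotated stripe `θ⁻¹ E(ε)` (used for unit complex numbers `θ`). -/
def rotatedStripe (ε : ℝ) (θ : ℂ) : Set ℂ :=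
  (fun z : ℂ => θ⁻¹ * z) '' stripe ε

/-- The Gaussian prime `1 + 2i` above `5`. -/
def P₅ : ℂ := 1 + 2 * Complex.I

/-- The Gaussian prime `2 + 3i` above `13`. -/
def P₁₃ : ℂ := 2 + 3 * Complex.I

/-- The unit complex number `(1 + 2i) / (1 - 2i)`. -/
def θ₅ : ℂ := P₅ / (starRingEnd ℂ) P₅

/-- The unit complex number `(2 + 3i) / (2 - 3i)`. -/
def θ₁₃ : ℂ := P₁₃ / (starRingEnd ℂ) P₁₃

/-- `Θ_N`, the set of all `θ₅ ^ r * θ₁₃ ^ s` with `0 ≤ r, s ≤ N`. -/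
def Θ (N : ℕ) : Set ℂ :=
  {z : ℂ | ∃ r s : ℕ, r ≤ N ∧ s ≤ N ∧ z = θ₅ ^ r * θ₁₃ ^ s}

/-- Unit complex numbers `ζ₁, ζ₂, ζ₃` with `n (ζ₁ + ζ₂) = ζ₃`. -/
def IsTriple (n : ℕ) (ζ₁ ζ₂ ζ₃ : ℂ) : Prop :=
  ‖ζ₁‖ = 1 ∧ ‖ζ₂‖ = 1 ∧ ‖ζ₃‖ = 1 ∧ (n : ℂ) * (ζ₁ + ζ₂) = ζ₃

/-- The set of rotations `ζ₁ Θ_N ∪ ζ₂ Θ_N ∪ ζ₃ Θ_N`. -/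
def Θ' (N : ℕ) (ζ₁ ζ₂ ζ₃ : ℂ) : Set ℂ :=
  (fun θ : ℂ => ζ₁ * θ) '' Θ N ∪ (fun θ : ℂ => ζ₂ * θ) '' Θ N ∪ (fun θ : ℂ => ζ₃ * θ) '' Θ N

end Pyjama

end

/-!
The plane is covered because of a rigidity property of `ℤ[i][1/π₅, 1/π₁₃]`, where `π₅ = 1 - 2i` and
`π₁₃ = 2 - 3i`, under multiplication by `π̄₅ / π₅` and `π̄₁₃ / π₁₃`, in the spirit of Furstenberg's
theorem on multiplication by `2` and `3`.

A point `z` of the plane defines the real character `flow z : x ↦ Re (z x)` modulo `1` of this ring,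
and `z` lies outside all stripes rotated by the multipliers exactly when `flow z` avoids the
`ε`-neighbourhood of `0` at all multipliers. The characters form a compact group `Sol`, on which the
multipliers act by `shift`. Near `0`, a character is the sum of a small real character and a
character that is trivial on a fine lattice (`Sol.eventually_eq_flow_add`). The multipliers act as
rotations on the real characters, while each of them expands one of the two `p`-adic directions and
is a rotation of infinite order in the other. Hence the multiples of a nonzero character that is
trivial on a fine lattice spread out over the whole group, even with multipliers restricted to be
close to `1` in the plane (`Sol.spread`). This rests on the fact that the powers of `π̄₁₃ / π₁₃`
represent all residues congruent to `1` modulo a fixed power of `π₅`, and conversely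
(`SplitPair.exists_generating_pow`).

The theorem behind the covering is that some positive integer `n = n(ε)` carries all characters
avoiding the `ε`-neighbourhood of `0` to real characters (`Sol.exists_nsmul_eq_flow`). In a closed
invariant set without preperiodic points, spreading makes every character a difference of two
members, so the set contains long progressions `x, x + d, …, x + N d` with `d` periodic and
`d(1) = 1 / N`, one term of which is close to `0` at `1`. So nonempty closed invariant sets of
avoiding characters contain preperiodic ones (`Sol.exists_isPreperiodic`). This applies to the set of
avoiding characters approximated by others in a nonreal direction; but at a preperiodic point of that
set, spreading again produces a value close to `0`. So that set is empty
(`Sol.transverse_eq_empty`), the avoiding characters lie on finitely many cosets of the group of real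
characters, and pigeonholing along an orbit gives `n`.

Finally, if the rotations failed to cover for every `N`, compactness would give avoiding characters
`χ₁`, `χ₂` with `χ₃ = n (χ₁ + χ₂)` avoiding as well. But `χ₃` would be a real character, and real
characters do take values close to `0`, since the rotation by `π̄₅ / π₅` has infinite order.
-/

namespace Pyjama

open GaussianInt Complex Filter Topology

/-! ### Powers of Gaussian integers modulo powers of a split prime -/

/-- The arithmetic input on a pair `p, q` of Gaussian integers: `p` has prime norm `c`, its residue
field is represented by `0, …, c - 1`, and `p` divides none of `p̄`, `q`, `q̄`. -/
structure SplitPair (p q : GaussianInt) (c : ℕ) : Prop where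
  prime : c.Prime
  norm_eq : (c : GaussianInt) = p * star p
  residue : ∀ g : GaussianInt, ∃ l : ℕ, l < c ∧ p ∣ g - l
  not_dvd_star : ¬ p ∣ star p
  not_dvd : ¬ p ∣ q
  not_dvd_star' : ¬ p ∣ star q

namespace SplitPair

variable {p q : GaussianInt} {c : ℕ}

theorem prime_left (h : SplitPair p q c) : Prime p := by
  have hn : p.norm = c := by
    have h1 := Zsqrtd.norm_eq_mul_conj p
    rw [← h.norm_eq] at h1
    have h2 := congrArg Zsqrtd.re h1
    simpa using h2
  have hp : Irreducible p := by
    refine ⟨fun hu => ?_, fun a b hab => ?_⟩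
    · rw [← Zsqrtd.norm_eq_one_iff, hn, Int.natAbs_natCast] at hu
      exact h.prime.one_lt.ne' hu
    · have h3 : a.norm.natAbs * b.norm.natAbs = c := by
        rw [← Int.natAbs_mul, ← Zsqrtd.norm_mul, ← hab, hn, Int.natAbs_natCast]
      rw [← Zsqrtd.norm_eq_one_iff, ← Zsqrtd.norm_eq_one_iff]
      rcases (Nat.prime_mul_iff.1 (h3 ▸ h.prime)) with h4 | h4
      · exact Or.inr h4.2
      · exact Or.inl h4.2
  exact hp.prime

theorem ne_zero (h : SplitPair p q c) : p ≠ 0 := h.prime_left.ne_zero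

theorem isCoprime_of_not_dvd (h : SplitPair p q c) {g : GaussianInt} (hg : ¬ p ∣ g) :
    IsCoprime p g :=
  h.prime_left.irreducible.coprime_iff_not_dvd.2 hg

/-- Lifting the exponent by one step. The binomial expansion of `(Y + pⁿe)^c` is
`Y^c + c Y^(c-1) pⁿ e` modulo `p²ⁿ`, and `p` divides `c` exactly once. -/
theorem pow_sub_pow_step (h : SplitPair p q c) {X Y e : GaussianInt} {n : ℕ} (hn : 2 ≤ n)
    (hY : ¬ p ∣ Y) (he : ¬ p ∣ e) (hX : X - Y = p ^ n * e) :
    ∃ e', ¬ p ∣ e' ∧ X ^ c - Y ^ c = p ^ (n + 1) * e' := by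
  obtain ⟨z, hz⟩ := Polynomial.powAddExpansion Y (p ^ n * e) c
  obtain ⟨k, rfl⟩ := Nat.exists_eq_add_of_le hn
  refine ⟨star p * Y ^ (c - 1) * e + p * (p ^ k * e ^ 2 * z), ?_, ?_⟩
  · rw [dvd_add_left (dvd_mul_right _ _)]
    intro hd
    rcases h.prime_left.dvd_or_dvd hd with h1 | h1
    · rcases h.prime_left.dvd_or_dvd h1 with h2 | h2
      · exact h.not_dvd_star h2
      · exact hY (h.prime_left.dvd_of_dvd_pow h2)
    · exact he h1
  · have hX' : X = Y + p ^ (2 + k) * e := by rw [← hX]; ring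
    rw [hX', hz, h.norm_eq]
    ring

theorem pow_sub_pow_iterate (h : SplitPair p q c) {X Y e : GaussianInt} {n : ℕ} (hn : 2 ≤ n)
    (hY : ¬ p ∣ Y) (he : ¬ p ∣ e) (hX : X - Y = p ^ n * e) (i : ℕ) :
    ∃ e', ¬ p ∣ e' ∧ X ^ c ^ i - Y ^ c ^ i = p ^ (n + i) * e' := by
  induction i with
  | zero => exact ⟨e, he, by simpa using hX⟩
  | succ i ih =>
    obtain ⟨e', he', h1⟩ := ih
    obtain ⟨e'', he'', h2⟩ := h.pow_sub_pow_step (n := n + i) (by omega)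
      (fun hd => hY (h.prime_left.dvd_of_dvd_pow hd)) he' h1
    exact ⟨e'', he'', by rw [pow_succ, pow_mul, pow_mul, h2, add_assoc]⟩

/-- If `X / Y ≡ 1` modulo exactly `pⁿ` with `n ≥ 2`, then the powers of `X / Y` represent every
residue class `1 + pⁿ g` modulo every `p^(n+k)`, with exponents at most `c^k`. -/
theorem exists_pow_sub_dvd (h : SplitPair p q c) {X Y e : GaussianInt} {n : ℕ} (hn : 2 ≤ n)
    (hXp : ¬ p ∣ X) (hY : ¬ p ∣ Y) (he : ¬ p ∣ e) (hX : X - Y = p ^ n * e) (g : GaussianInt)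
    (k : ℕ) : ∃ s ≤ c ^ k, p ^ (n + k) ∣ X ^ s - (1 + p ^ n * g) * Y ^ s := by
  induction k with
  | zero => exact ⟨0, by simp, -g, by simp⟩
  | succ k ih =>
    obtain ⟨s, hs, f, hf⟩ := ih
    obtain ⟨e', he', h1⟩ := h.pow_sub_pow_iterate hn hY he hX k
    set Y' := Y ^ c ^ k with hY'
    have hpX : ¬ p ∣ X ^ s * e' := fun hd => by
      rcases h.prime_left.dvd_or_dvd hd with h2 | h2
      · exact hXp (h.prime_left.dvd_of_dvd_pow h2)
      · exact he' h2
    -- `l` solves the linear congruence `f Y' + l X ^ s e' ≡ 0` modulo `p`.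
    obtain ⟨α, β, hαβ⟩ := (h.isCoprime_of_not_dvd hpX)
    obtain ⟨l, hl, d, hd⟩ := h.residue (-(f * Y') * β)
    have hl' : p ∣ f * Y' + l * (X ^ s * e') := by
      refine ⟨f * Y' * α - d * (X ^ s * e'), ?_⟩
      linear_combination (-(f * Y')) * hαβ - (X ^ s * e') * hd
    refine ⟨s + c ^ k * l, ?_, ?_⟩
    · calc s + c ^ k * l ≤ c ^ k + c ^ k * (c - 1) := by
            gcongr; omega
        _ = c ^ (k + 1) := by
            obtain ⟨b, rfl⟩ : ∃ b, c = b + 1 := ⟨c - 1, by have := h.prime.pos; omega⟩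
            simp; ring
    · obtain ⟨z, hz⟩ := Polynomial.powAddExpansion Y' (p ^ (n + k) * e') l
      have hX' : X ^ c ^ k = Y' + p ^ (n + k) * e' := by rw [← h1]; ring
      have key : X ^ (s + c ^ k * l) - (1 + p ^ n * g) * Y ^ (s + c ^ k * l) =
          p ^ (n + k) * (f * Y' ^ l + l * Y' ^ (l - 1) * (X ^ s * e')) +
            p ^ (n + k) * p ^ (n + k) * (X ^ s * z * e' ^ 2) := by
        rw [pow_add, pow_mul, hX', hz, pow_add Y, pow_mul Y, ← hY']
        linear_combination (Y' ^ l) * hf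
      rw [key, ← add_assoc, pow_succ p (n + k)]
      refine dvd_add (mul_dvd_mul_left _ ?_) (Dvd.dvd.mul_right (mul_dvd_mul_left _ ?_) _)
      · rcases Nat.eq_zero_or_pos l with rfl | hl0
        · have : p ∣ f := by
            have h3 : p ∣ f * Y' := by simpa using hl'
            rcases h.prime_left.dvd_or_dvd h3 with h4 | h4
            · exact h4
            · exact absurd (h.prime_left.dvd_of_dvd_pow h4) hY
          simpa using this
        · obtain ⟨j, rfl⟩ : ∃ j, l = j + 1 := ⟨l - 1, by omega⟩
          convert hl'.mul_left (Y' ^ j) using 1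
          simp; ring
      · exact dvd_pow_self _ (by omega)

/-- Fermat's theorem in the residue field of `p`. -/
theorem dvd_pow_sub_one (h : SplitPair p q c) {g : GaussianInt} (hg : ¬ p ∣ g) :
    p ∣ g ^ (c - 1) - 1 := by
  obtain ⟨l, hl, hgl⟩ := h.residue g
  have hl0 : IsCoprime (l : ℤ) (c : ℤ) := by
    rw [Nat.isCoprime_iff_coprime, Nat.coprime_comm, Nat.Prime.coprime_iff_not_dvd h.prime]
    intro hcl
    have : l = 0 := Nat.eq_zero_of_dvd_of_lt hcl hl
    subst this
    exact hg (by simpa using hgl)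
  have h1 := (Int.ModEq.pow_card_sub_one_eq_one h.prime hl0).symm.dvd
  obtain ⟨d, hd⟩ := h1
  have h2 : p ∣ (l : GaussianInt) ^ (c - 1) - 1 := by
    have h3 := congrArg (Int.cast : ℤ → GaussianInt) hd
    push_cast at h3
    rw [h3, h.norm_eq]
    exact ⟨star p * d, by ring⟩
  have h4 := hgl.trans (sub_dvd_pow_sub_pow g (l : GaussianInt) (c - 1))
  have h5 := dvd_add h4 h2
  simpa using h5

theorem sq_dvd_pow_sub_pow (h : SplitPair p q c) (b : ℕ) :
    p ^ 2 ∣ star q ^ (b * ((c - 1) * c)) - q ^ (b * ((c - 1) * c)) := by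
  have h1 : p ∣ star q ^ (c - 1) - q ^ (c - 1) := by
    have := dvd_sub (h.dvd_pow_sub_one h.not_dvd_star') (h.dvd_pow_sub_one h.not_dvd)
    simpa using this
  obtain ⟨e, he⟩ := h1
  have h2 : p ^ 2 ∣ star q ^ ((c - 1) * c) - q ^ ((c - 1) * c) := by
    obtain ⟨z, hz⟩ := Polynomial.powAddExpansion (q ^ (c - 1)) (p * e) c
    have hX' : star q ^ (c - 1) = q ^ (c - 1) + p * e := by rw [← he]; ring
    rw [pow_mul, pow_mul, hX', hz, h.norm_eq]
    exact ⟨star p * (q ^ (c - 1)) ^ (c - 1) * e + z * e ^ 2, by ring⟩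
  rw [mul_comm b, pow_mul _ _ b, pow_mul _ _ b]
  exact h2.trans (sub_dvd_pow_sub_pow _ _ _)

/-- The quotient `p̄ / p` has infinite order in the multiplicative group. -/
theorem star_pow_ne (h : SplitPair p q c) {n : ℕ} (hn : n ≠ 0) : star p ^ n ≠ p ^ n := fun he =>
  h.not_dvd_star (h.prime_left.dvd_of_dvd_pow (he ▸ dvd_pow_self p hn))

/-- For every `b ≥ 1`, some power `(q̄ / q)^b'` with `b ∣ b'` generates, modulo every power of `p`,
all residues congruent to `1` modulo a fixed power `p ^ m`. -/
theorem exists_generating_pow (h : SplitPair p q c) (hq : ∀ n : ℕ, n ≠ 0 → star q ^ n ≠ q ^ n)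
    {b : ℕ} (hb : b ≠ 0) : ∃ b' m : ℕ, b ∣ b' ∧ b' ≠ 0 ∧ ∀ k : ℕ,
      p ^ k ∣ star q ^ (b' * c ^ k) - q ^ (b' * c ^ k) ∧ ∀ g : GaussianInt, ∃ s ≤ c ^ k,
        p ^ k ∣ star q ^ (b' * s) - (1 + p ^ m * g) * q ^ (b' * s) := by
  obtain ⟨b', hb'⟩ : ∃ b', b' = b * ((c - 1) * c) := ⟨_, rfl⟩
  have hb0 : b' ≠ 0 := by
    have := h.prime.two_le
    have h1 : c - 1 ≠ 0 := by omega
    have h2 : c ≠ 0 := by omega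
    rw [hb']
    positivity
  obtain ⟨m, e, he, hm⟩ := WfDvdMonoid.max_power_factor (sub_ne_zero.2 (hq b' hb0))
    h.prime_left.irreducible
  have hY : ¬ p ∣ q ^ b' := fun hd => h.not_dvd (h.prime_left.dvd_of_dvd_pow hd)
  have hX : ¬ p ∣ star q ^ b' := fun hd => h.not_dvd_star' (h.prime_left.dvd_of_dvd_pow hd)
  have hm2 : 2 ≤ m := by
    by_contra hlt
    have h1 := h.sq_dvd_pow_sub_pow b
    rw [← hb', hm] at h1
    apply he
    have hm1 : m ≤ 1 := by omega
    have h2 : p ^ m * p ∣ p ^ m * e := by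
      refine dvd_trans ?_ h1
      rw [← pow_succ]
      exact pow_dvd_pow _ (by omega)
    exact (mul_dvd_mul_iff_left (pow_ne_zero _ h.ne_zero)).1 h2
  refine ⟨b', m, Dvd.intro _ hb'.symm, hb0, fun k => ⟨?_, fun g => ?_⟩⟩
  · obtain ⟨e', -, h1⟩ := h.pow_sub_pow_iterate hm2 hY he hm k
    rw [pow_mul, pow_mul, h1, pow_add]
    exact ⟨p ^ m * e', by ring⟩
  · obtain ⟨s, hs, h1⟩ := h.exists_pow_sub_dvd hm2 hX hY he hm g k
    refine ⟨s, hs, ?_⟩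
    rw [pow_mul, pow_mul]
    exact (pow_dvd_pow p (by omega : k ≤ m + k)).trans h1

end SplitPair

theorem splitPair_five : SplitPair ⟨1, -2⟩ ⟨2, -3⟩ 5 := by
  refine ⟨by norm_num, by ext <;> simp, fun g => ?_, ?_, ?_, ?_⟩
  -- Modulo `1 - 2i`, the unit `i` is congruent to `3`.
  · refine ⟨((g.re + 3 * g.im) % 5).toNat, by omega, ?_⟩
    set l := ((g.re + 3 * g.im) % 5).toNat with hl
    have hl' : (l : ℤ) = (g.re + 3 * g.im) % 5 := by omega
    refine ⟨⟨(g.re - l - 2 * g.im) / 5, (2 * (g.re - l) + g.im) / 5⟩, ?_⟩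
    ext <;> simp <;> omega
  all_goals
    rintro ⟨⟨a, b⟩, h⟩
    have h1 := congrArg Zsqrtd.re h
    have h2 := congrArg Zsqrtd.im h
    simp at h1 h2
    omega

theorem splitPair_thirteen : SplitPair ⟨2, -3⟩ ⟨1, -2⟩ 13 := by
  refine ⟨by norm_num, by ext <;> simp, fun g => ?_, ?_, ?_, ?_⟩
  -- Modulo `2 - 3i`, the unit `i` is congruent to `5`.
  · refine ⟨((g.re + 5 * g.im) % 13).toNat, by omega, ?_⟩
    set l := ((g.re + 5 * g.im) % 13).toNat with hl
    have hl' : (l : ℤ) = (g.re + 5 * g.im) % 13 := by omega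
    refine ⟨⟨(2 * (g.re - l) - 3 * g.im) / 13, (3 * (g.re - l) + 2 * g.im) / 13⟩, ?_⟩
    ext <;> simp <;> omega
  all_goals
    rintro ⟨⟨a, b⟩, h⟩
    have h1 := congrArg Zsqrtd.re h
    have h2 := congrArg Zsqrtd.im h
    simp at h1 h2
    omega

/-! ### Rotations -/

/-- The unit complex number `p̄ / p`. -/
noncomputable def rot (p : GaussianInt) : ℂ := toComplex (star p) / toComplex p

theorem norm_rot {p : GaussianInt} (hp : p ≠ 0) : ‖rot p‖ = 1 := by
  have : ‖toComplex p‖ ≠ 0 := by simpa using hp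
  rw [rot, norm_div, toComplex_star, RCLike.norm_conj, div_self this]

theorem rot_pow_ne_one {p : GaussianInt} (hp : p ≠ 0) {n : ℕ} (h : star p ^ n ≠ p ^ n) :
    rot p ^ n ≠ 1 := by
  have hp' : toComplex p ^ n ≠ 0 := pow_ne_zero _ (by simpa using hp)
  rw [rot, div_pow, Ne, div_eq_one_iff_eq hp', ← map_pow, ← map_pow, toComplex_inj]
  exact h

/-- A rotation of infinite order takes every unit complex number close to `1`, and the number of
steps needed is bounded independently of the starting point. -/
theorem exists_pow_mul_near_one {η : ℂ} (hη : ‖η‖ = 1) (hinf : ∀ n : ℕ, n ≠ 0 → η ^ n ≠ 1)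
    {δ : ℝ} (hδ : 0 < δ) : ∃ I : ℕ, ∀ ω : ℂ, ‖ω‖ = 1 → ∃ i ≤ I, ‖η ^ i * ω - 1‖ < δ := by
  let z : Circle := ⟨η, mem_sphere_zero_iff_norm.2 hη⟩
  let a : UnitAddCircle := (AddCircle.homeomorphCircle one_ne_zero).symm z
  have haz : AddCircle.toCircle a = z := by
    rw [← AddCircle.homeomorphCircle_apply one_ne_zero]
    exact (AddCircle.homeomorphCircle one_ne_zero).apply_symm_apply z
  have ha : DenseRange (fun n : ℕ => n • a) := by
    rw [← denseRange_zsmul_iff_nsmul, AddCircle.denseRange_zsmul_iff, addOrderOf_eq_zero_iff']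
    intro n hn h0
    apply hinf n hn.ne'
    have h1 := AddCircle.toCircle_nsmul a n
    rw [h0, AddCircle.toCircle_zero, haz] at h1
    have h2 := congrArg (Subtype.val) h1
    rw [Circle.coe_pow] at h2
    exact h2.symm
  have hz : DenseRange (fun n : ℕ => z ^ n) := by
    have h1 := (AddCircle.homeomorphCircle (T := 1) one_ne_zero).surjective.denseRange.comp ha
      (AddCircle.homeomorphCircle one_ne_zero).continuous
    convert h1 using 2 with n
    simp [AddCircle.homeomorphCircle_apply, AddCircle.toCircle_nsmul, haz]
  have hopen : ∀ i : ℕ, IsOpen {ω : Circle | ‖η ^ i * (ω : ℂ) - 1‖ < δ} := fun i =>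
    isOpen_lt (by fun_prop) continuous_const
  have hcov : (Set.univ : Set Circle) ⊆ ⋃ i : ℕ, {ω : Circle | ‖η ^ i * (ω : ℂ) - 1‖ < δ} := by
    intro ω _
    have ho : IsOpen {u : Circle | ‖(u : ℂ) * ω - 1‖ < δ} :=
      isOpen_lt (by fun_prop) continuous_const
    obtain ⟨i, hi⟩ := hz.exists_mem_open ho ⟨ω⁻¹, by
      have : ((ω⁻¹ : Circle) : ℂ) * ω = 1 := by rw [← Circle.coe_mul]; simp
      simpa [this] using hδ⟩
    exact Set.mem_iUnion.2 ⟨i, by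
      rw [Set.mem_ofPred_eq, Circle.coe_pow] at hi
      exact hi⟩
  obtain ⟨t, ht⟩ := isCompact_univ.elim_finite_subcover _ hopen hcov
  refine ⟨t.sup id, fun ω hω => ?_⟩
  have h1 := ht (Set.mem_univ (⟨ω, mem_sphere_zero_iff_norm.2 hω⟩ : Circle))
  obtain ⟨i, hi, h2⟩ := Set.mem_iUnion₂.1 h1
  exact ⟨i, Finset.le_sup (f := id) hi, h2⟩

/-! ### Characters of the Gaussian integers -/

theorem coe_eq_zero_of_int {x : ℝ} (n : ℤ) (h : x = n) : (x : UnitAddCircle) = 0 := by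
  rw [AddCircle.coe_eq_zero_iff]
  exact ⟨n, by simp [h]⟩

theorem coe_re_toComplex (g : GaussianInt) : ((toComplex g).re : UnitAddCircle) = 0 :=
  coe_eq_zero_of_int g.re (GaussianInt.intCast_re g).symm

theorem norm_coe_le_abs (x : ℝ) : ‖(x : UnitAddCircle)‖ ≤ |x| := by
  rw [UnitAddCircle.norm_eq]
  simpa using round_le x 0

theorem exists_lift_abs_eq_norm (t : UnitAddCircle) :
    ∃ u : ℝ, (u : UnitAddCircle) = t ∧ |u| = ‖t‖ := by
  induction t using QuotientAddGroup.induction_on with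
  | H x =>
    refine ⟨x - round x, ?_, (UnitAddCircle.norm_eq (x := x)).symm⟩
    rw [AddCircle.coe_sub, coe_eq_zero_of_int (round x) rfl, sub_zero]

theorem norm_coe_re_mul_le (w x : ℂ) : ‖((w * x).re : UnitAddCircle)‖ ≤ ‖w‖ * ‖x‖ :=
  (norm_coe_le_abs _).trans ((abs_re_le_norm _).trans (norm_mul w x).le)

/-- Every character of `ℤ[i]` has the form `x ↦ Re (w x)` modulo `1`, with `w` controlled by the
values at `1` and `i`. -/
theorem exists_eq_re_mul (ψ : GaussianInt →+ UnitAddCircle) :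
    ∃ w : ℂ, (∀ x, ψ x = ((w * toComplex x).re : UnitAddCircle)) ∧ ‖w‖ ≤ ‖ψ 1‖ + ‖ψ ⟨0, 1⟩‖ := by
  obtain ⟨u, hu, hu'⟩ := exists_lift_abs_eq_norm (ψ 1)
  obtain ⟨v, hv, hv'⟩ := exists_lift_abs_eq_norm (ψ ⟨0, 1⟩)
  refine ⟨⟨u, -v⟩, fun x => ?_, ?_⟩
  · have hx : x = x.re • (1 : GaussianInt) + x.im • (⟨0, 1⟩ : GaussianInt) := by
      ext <;> simp
    have h1 : ((⟨u, -v⟩ : ℂ) * toComplex x).re = x.re • u + x.im • v := by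
      rw [mul_re, ← GaussianInt.intCast_re, ← GaussianInt.intCast_im, zsmul_eq_mul, zsmul_eq_mul]; ring
    rw [h1, AddCircle.coe_add, AddCircle.coe_zsmul, AddCircle.coe_zsmul, hu, hv, ← map_zsmul,
      ← map_zsmul, ← map_add, ← hx]
  · rw [← hu', ← hv']
    simpa using Complex.norm_le_abs_re_add_abs_im (⟨u, -v⟩ : ℂ)

theorem exists_toComplex_eq {w : ℂ}
    (h : ∀ x : GaussianInt, ((w * toComplex x).re : UnitAddCircle) = 0) :
    ∃ y : GaussianInt, toComplex y = w := by
  have h1 := h 1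
  have h2 := h ⟨0, -1⟩
  rw [AddCircle.coe_eq_zero_iff] at h1 h2
  obtain ⟨a, ha⟩ := h1
  obtain ⟨b, hb⟩ := h2
  refine ⟨⟨a, b⟩, ?_⟩
  simp [toComplex_def₂] at ha hb ⊢
  rw [ha, hb]

theorem exists_toComplex_near (z : ℂ) : ∃ h : GaussianInt, ‖toComplex h - z‖ ≤ 1 := by
  refine ⟨⟨round z.re, round z.im⟩, ?_⟩
  have h1 := abs_sub_round z.re
  have h2 := abs_sub_round z.im
  have h3 := Complex.norm_le_abs_re_add_abs_im (toComplex ⟨round z.re, round z.im⟩ - z)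
  rw [abs_sub_comm] at h1 h2
  simp only [sub_re, sub_im, re_toComplex, im_toComplex] at h3
  linarith

/-! ### The solenoid and the spreading of small characters -/

/-- The group of characters of `ℤ[i][1/p, 1/q]`: the value of the character at `g / (p ^ k * q ^ l)`
is recorded as `f g k l`, so the members are the functions additive in `g` and compatible with
cancelling `p` and `q`. -/
def Solenoid (p q : GaussianInt) : AddSubgroup (GaussianInt → ℕ → ℕ → UnitAddCircle) where
  carrier := {f | (∀ g h k l, f (g + h) k l = f g k l + f h k l) ∧
    (∀ g k l, f (p * g) (k + 1) l = f g k l) ∧ ∀ g k l, f (q * g) k (l + 1) = f g k l}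
  zero_mem' := ⟨by simp, by simp, by simp⟩
  add_mem' := by
    rintro f f' ⟨h1, h2, h3⟩ ⟨h1', h2', h3'⟩
    refine ⟨fun g h k l => ?_, fun g k l => ?_, fun g k l => ?_⟩
    · simp only [Pi.add_apply, h1, h1']; abel
    · simp only [Pi.add_apply, h2, h2']
    · simp only [Pi.add_apply, h3, h3']
  neg_mem' := by
    rintro f ⟨h1, h2, h3⟩
    refine ⟨fun g h k l => ?_, fun g k l => ?_, fun g k l => ?_⟩
    · simp only [Pi.neg_apply, h1]; abel
    · simp only [Pi.neg_apply, h2]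
    · simp only [Pi.neg_apply, h3]

namespace Solenoid

variable {p q : GaussianInt} {f : GaussianInt → ℕ → ℕ → UnitAddCircle}

theorem map_add' (hf : f ∈ Solenoid p q) (g h : GaussianInt) (k l : ℕ) :
    f (g + h) k l = f g k l + f h k l := hf.1 g h k l

/-- The restriction of a character to the lattice `p⁻ᵏ q⁻ˡ ℤ[i]`. -/
def hom (hf : f ∈ Solenoid p q) (k l : ℕ) : GaussianInt →+ UnitAddCircle :=
  AddMonoidHom.mk' (fun g => f g k l) fun g h => hf.1 g h k l

@[simp] theorem hom_apply (hf : f ∈ Solenoid p q) (k l : ℕ) (g : GaussianInt) :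
    hom hf k l g = f g k l := rfl

theorem pow_mul_left (hf : f ∈ Solenoid p q) (n : ℕ) (g : GaussianInt) (k l : ℕ) :
    f (p ^ n * g) (k + n) l = f g k l := by
  induction n with
  | zero => simp
  | succ n ih => rw [pow_succ', mul_assoc, ← add_assoc, hf.2.1, ih]

theorem pow_mul_right (hf : f ∈ Solenoid p q) (n : ℕ) (g : GaussianInt) (k l : ℕ) :
    f (q ^ n * g) k (l + n) = f g k l := by
  induction n with
  | zero => simp
  | succ n ih => rw [pow_succ', mul_assoc, ← add_assoc, hf.2.2, ih]

theorem swap (hf : f ∈ Solenoid p q) : (fun g k l => f g l k) ∈ Solenoid q p :=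
  ⟨fun g h k l => hf.1 g h l k, fun g k l => hf.2.2 g l k, fun g k l => hf.2.1 g l k⟩

theorem eq_zero_of_le (hf : f ∈ Solenoid p q) {M : ℕ} (h : ∀ g, f g M M = 0) {k l : ℕ}
    (hk : k ≤ M) (hl : l ≤ M) (g : GaussianInt) : f g k l = 0 := by
  obtain ⟨a, rfl⟩ := Nat.exists_eq_add_of_le hk
  rw [← pow_mul_left hf a, ← pow_mul_right hf (k + a - l), Nat.add_sub_cancel' hl, h]

/-- A character vanishing on `p⁻ᵏ ℤ[i]` and on `q⁻ˡ ℤ[i]` vanishes on their sum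
`p⁻ᵏ q⁻ˡ ℤ[i]`. -/
theorem eq_zero_of_isCoprime (hf : f ∈ Solenoid p q) (hpq : IsCoprime p q) {k l : ℕ}
    (hk : ∀ g, f g k 0 = 0) (hl : ∀ g, f g 0 l = 0) (g : GaussianInt) : f g k l = 0 := by
  obtain ⟨α, β, h⟩ := (hpq.pow (m := k) (n := l))
  have hg : g = p ^ k * (α * g) + q ^ l * (β * g) := by linear_combination (-g) * h
  have h1 := pow_mul_left hf k (α * g) 0 l
  have h2 := pow_mul_right hf l (β * g) k 0
  rw [zero_add] at h1 h2
  rw [hg, map_add' hf, h1, h2, hk, hl, add_zero]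

/-- A character that vanishes on a fine lattice but is nontrivial in the `p`-direction is spread out
by multiplication by powers of `p̄ / p` and `q̄ / q`: on a prescribed coarse lattice, the resulting
characters come close to any given one, and the multipliers can be taken close to `1`. -/
theorem spread_left {c : ℕ} (h : SplitPair p q c) (hq : ∀ n : ℕ, n ≠ 0 → star q ^ n ≠ q ^ n)
    (hq0 : q ≠ 0) {a b : ℕ} (ha : a ≠ 0) (hb : b ≠ 0) (m : ℕ) {δ : ℝ} (hδ : 0 < δ) :
    ∃ M : ℕ, ∀ f ∈ Solenoid p q, (∀ g, f g M M = 0) → (∃ g k, f g k 0 ≠ 0) → ∀ v : ℂ,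
      ∃ r s : ℕ, a ∣ r ∧ b ∣ s ∧ ‖rot p ^ r * rot q ^ s - 1‖ < δ ∧ ∃ w : ℂ, ‖w - v‖ < δ ∧
        ∀ x, f (star p ^ r * star q ^ s * x) (m + r) (m + s) =
          ((w * toComplex x).re : UnitAddCircle) := by
  obtain ⟨b', m₀, hbb', hb', hgen⟩ := h.exists_generating_pow hq hb
  have hp0 : toComplex p ≠ 0 := by simpa using h.ne_zero
  have hpn : 1 < ‖toComplex p‖ := by
    have h1 := congrArg toComplex h.norm_eq
    rw [map_natCast, toComplex_mul, toComplex_star] at h1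
    have h2 : (c : ℝ) = ‖toComplex p‖ * ‖toComplex p‖ := by
      have := congrArg norm h1
      simpa using this
    have h3 : (1 : ℝ) < c := by exact_mod_cast h.prime.one_lt
    nlinarith [norm_nonneg (toComplex p)]
  -- For `K ≥ k`, the lattice `p ^ (m₀ - K) ℤ[i]` is `δ`-dense in the plane.
  obtain ⟨k, hk⟩ : ∃ k : ℕ, ∀ K, k ≤ K → ‖toComplex p ^ m₀ / toComplex p ^ K‖ < δ := by
    have h1 : Tendsto (fun K : ℕ => ‖toComplex p‖ ^ m₀ * (‖toComplex p‖⁻¹) ^ K) atTop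
        (𝓝 (‖toComplex p‖ ^ m₀ * 0)) :=
      (tendsto_pow_atTop_nhds_zero_of_lt_one (by positivity) (inv_lt_one_of_one_lt₀ hpn)).const_mul _
    rw [mul_zero] at h1
    obtain ⟨k, hk⟩ := eventually_atTop.1 (h1.eventually_lt_const hδ)
    refine ⟨k, fun K hK => ?_⟩
    have := hk K hK
    simpa [div_eq_mul_inv] using this
  set k₁ := k + m + a with hk₁
  set L := b' * c ^ k₁ with hL
  have hL0 : L ≠ 0 := mul_ne_zero hb' (pow_ne_zero _ h.prime.ne_zero)
  have hrq : ‖rot q‖ = 1 := norm_rot hq0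
  obtain ⟨I, hI⟩ := exists_pow_mul_near_one (η := rot q ^ L) (by simp [hrq])
    (fun n hn => by
      rw [← pow_mul]
      exact rot_pow_ne_one hq0 (hq _ (mul_ne_zero hL0 hn))) hδ
  refine ⟨m + L + L * I, fun f hf hfM hfne v => ?_⟩
  set M := m + L + L * I with hM
  have hpq : IsCoprime p q := h.isCoprime_of_not_dvd h.not_dvd
  -- `j` is the least exponent such that `f` is nontrivial on `p⁻ʲ ℤ[i]`.
  have hex : ∃ k, ∃ g, f g k 0 ≠ 0 := by
    obtain ⟨g, k, hg⟩ := hfne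
    exact ⟨k, g, hg⟩
  classical
  set j := Nat.find hex with hj
  obtain ⟨g₀, hg₀⟩ := Nat.find_spec hex
  have hjmin : ∀ k < j, ∀ g, f g k 0 = 0 := fun k hk g => by
    by_contra hne
    exact Nat.find_min hex hk ⟨g, hne⟩
  have hjM : M < j := by
    by_contra hle
    exact hg₀ (eq_zero_of_le hf hfM (not_lt.1 hle) (Nat.zero_le _) g₀)
  have hvan : ∀ l ≤ M, ∀ g, f g (j - 1) l = 0 := fun l hl g =>
    eq_zero_of_isCoprime hf hpq (hjmin _ (by omega))
      (fun g => eq_zero_of_le hf hfM (Nat.zero_le _) hl g) g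
  -- `r` is a multiple of `a` for which `p ^ K` kills the shifted character on the coarse lattice,
  -- with `K` large but bounded.
  obtain ⟨r, K, har, hrK, hkK, hKk⟩ : ∃ r K : ℕ, a ∣ r ∧ m + r = K + (j - 1) ∧ k < K ∧ K ≤ k₁ := by
    refine ⟨a * ((k + j - 1) / a + 1), m + a * ((k + j - 1) / a + 1) - (j - 1), Dvd.intro _ rfl, ?_⟩
    have h1 := Nat.div_add_mod (k + j - 1) a
    have h2 := Nat.mod_lt (k + j - 1) (Nat.pos_of_ne_zero ha)
    rw [mul_add, mul_one]
    omega
  have hPr : IsCoprime p (star p ^ r) := (h.isCoprime_of_not_dvd h.not_dvd_star).pow_right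
  obtain ⟨w, hw⟩ : ∃ w : ℂ, ∀ x, f (star p ^ r * x) (m + r) m =
      ((w * toComplex x).re : UnitAddCircle) := by
    obtain ⟨w, hw, -⟩ := exists_eq_re_mul
      ((hom hf (m + r) m).comp (AddMonoidHom.mulLeft (star p ^ r)))
    exact ⟨w, fun x => by simpa using hw x⟩
  have hkill : ∀ (l : ℕ) (x : GaussianInt), f (p ^ K * x) (m + r) l = f x (j - 1) l :=
    fun l x => by
      rw [hrK, add_comm K, pow_mul_left hf]
  obtain ⟨y, hy⟩ : ∃ y : GaussianInt, toComplex y = w * toComplex p ^ K := by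
    refine exists_toComplex_eq fun x => ?_
    rw [mul_assoc, ← map_pow, ← toComplex_mul, ← hw, mul_left_comm, hkill]
    exact hvan m (by omega) _
  have hyp : ¬ p ∣ y := by
    rintro ⟨y', hy'⟩
    obtain ⟨K', rfl⟩ : ∃ K', K = K' + 1 := ⟨K - 1, by omega⟩
    have hz : ∀ x, f (star p ^ r * x) j m = 0 := fun x => by
      have h1 := pow_mul_left hf K' (star p ^ r * x) j m
      have h2 : j + K' = m + r := by omega
      rw [← h1, h2, mul_left_comm, hw, ← coe_re_toComplex (y' * x)]
      congr 2
      have h3 : toComplex p * toComplex y' = w * toComplex p ^ (K' + 1) := by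
        rw [← toComplex_mul, ← hy', hy]
      have h4 : toComplex y' = w * toComplex p ^ K' := by
        apply mul_left_cancel₀ hp0
        rw [h3, pow_succ]; ring
      rw [toComplex_mul, toComplex_mul, map_pow, h4, mul_assoc]
    apply hg₀
    obtain ⟨β, α, hαβ⟩ := hPr
    have h1 := pow_mul_right hf m g₀ j 0
    rw [zero_add] at h1
    rw [← hj, ← h1]
    have h2 : q ^ m * g₀ = star p ^ r * (α * (q ^ m * g₀)) + p ^ 1 * (β * (q ^ m * g₀)) := by
      linear_combination (-(q ^ m * g₀)) * hαβ
    have h3 := pow_mul_left hf 1 (β * (q ^ m * g₀)) (j - 1) m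
    rw [Nat.sub_add_cancel (by omega)] at h3
    rw [h2, map_add' hf, hz, h3, zero_add]
    exact hvan m (by omega) _
  obtain ⟨α, β, hαβ⟩ : ∃ α β, α * y + β * p ^ K = 1 :=
    (h.isCoprime_of_not_dvd hyp).symm.pow_right
  obtain ⟨t, ht⟩ := exists_toComplex_near ((v - w) * toComplex p ^ K / toComplex p ^ m₀)
  obtain ⟨hper, hres⟩ := hgen k₁
  obtain ⟨s₀, hs₀, hdvd⟩ := hres (α * t)
  obtain ⟨i, hi, hnear⟩ := hI (rot p ^ r * rot q ^ (b' * s₀)) (by simp [hrq, norm_rot h.ne_zero])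
  set s := b' * s₀ + L * i with hs
  have hsM : m + s ≤ M := by
    have h1 : b' * s₀ ≤ L := Nat.mul_le_mul_left _ hs₀
    have h2 : L * i ≤ L * I := Nat.mul_le_mul_left _ hi
    omega
  -- Multiplication by `(q̄ / q) ^ s` agrees with multiplication by `1 + p ^ m₀ * α * t`.
  obtain ⟨d, hd⟩ : p ^ K ∣ star q ^ s - (1 + p ^ m₀ * (α * t)) * q ^ s := by
    refine (pow_dvd_pow p hKk).trans ?_
    have h1 := hper.trans (sub_dvd_pow_sub_pow (star q ^ L) (q ^ L) i)
    rw [← pow_mul, ← pow_mul] at h1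
    have h2 := dvd_add (hdvd.mul_right (q ^ (L * i))) (h1.mul_left (star q ^ (b' * s₀)))
    convert h2 using 1
    rw [hs, pow_add, pow_add]
    ring
  refine ⟨r, s, har, ?_, ?_, w + toComplex t * (toComplex p ^ m₀ / toComplex p ^ K), ?_, fun x => ?_⟩
  · exact dvd_add (hbb'.mul_right _) ((hbb'.mul_right _).mul_right _)
  · convert hnear using 3
    rw [hs, pow_add, ← pow_mul]
    ring
  · have h1 : w + toComplex t * (toComplex p ^ m₀ / toComplex p ^ K) - v =
        (toComplex t - (v - w) * toComplex p ^ K / toComplex p ^ m₀) *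
          (toComplex p ^ m₀ / toComplex p ^ K) := by
      field_simp
      ring
    rw [h1, norm_mul]
    calc _ ≤ 1 * ‖toComplex p ^ m₀ / toComplex p ^ K‖ := by gcongr
      _ < δ := by rw [one_mul]; exact hk K hkK.le
  · have h1 : star p ^ r * star q ^ s * x = q ^ s * (star p ^ r * ((1 + p ^ m₀ * (α * t)) * x)) +
        p ^ K * (star p ^ r * d * x) := by
      linear_combination (star p ^ r * x) * hd
    rw [h1, map_add' hf, pow_mul_right hf, hkill, hvan _ hsM, add_zero, hw]
    have h2 : w * toComplex ((1 + p ^ m₀ * (α * t)) * x) =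
        (w + toComplex t * (toComplex p ^ m₀ / toComplex p ^ K)) * toComplex x -
          toComplex (β * t * p ^ m₀ * x) := by
      have h3 : toComplex α * (w * toComplex p ^ K) = 1 - toComplex β * toComplex p ^ K := by
        rw [← hy, ← map_pow, ← toComplex_mul, ← toComplex_mul, ← toComplex_one, ← toComplex_sub,
          ← hαβ]
        congr 1
        ring
      have h4 : toComplex α * w = (1 - toComplex β * toComplex p ^ K) / toComplex p ^ K := by
        rw [← h3]; field_simp
      simp only [toComplex_mul, toComplex_add, toComplex_one, map_pow]
      have h5 : w * ((1 + toComplex p ^ m₀ * (toComplex α * toComplex t)) * toComplex x) =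
          w * toComplex x + (toComplex α * w) * (toComplex p ^ m₀ * toComplex t * toComplex x) := by
        ring
      rw [h5, h4]
      field_simp
      ring
    rw [h2, sub_re, AddCircle.coe_sub, coe_re_toComplex, sub_zero]

end Solenoid

/-! ### The compact group of characters and its multipliers -/

/-- The Gaussian prime `1 - 2i` above `5`. -/
abbrev π₅ : GaussianInt := ⟨1, -2⟩

/-- The Gaussian prime `2 - 3i` above `13`. -/
abbrev π₁₃ : GaussianInt := ⟨2, -3⟩

/-- The compact group of characters of the ring `ℤ[i][1/π₅, 1/π₁₃]`. -/
abbrev Sol : Type := Solenoid π₅ π₁₃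

theorem π₅_ne_zero : toComplex π₅ ≠ 0 := by simpa using splitPair_five.ne_zero

theorem π₁₃_ne_zero : toComplex π₁₃ ≠ 0 := by simpa using splitPair_thirteen.ne_zero

/-- The multiplier `(π̄₅ / π₅) ^ r * (π̄₁₃ / π₁₃) ^ s`. -/
noncomputable def rotMul (r s : ℕ) : ℂ := rot π₅ ^ r * rot π₁₃ ^ s

theorem norm_rotMul (r s : ℕ) : ‖rotMul r s‖ = 1 := by
  simp [rotMul, norm_rot splitPair_five.ne_zero, norm_rot splitPair_thirteen.ne_zero]

namespace Sol

instance : CompactSpace Sol := by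
  refine isCompact_iff_compactSpace.1 (IsClosed.isCompact ?_)
  have h1 : IsClosed {f : GaussianInt → ℕ → ℕ → UnitAddCircle |
      ∀ g h k l, f (g + h) k l = f g k l + f h k l} := by
    simp only [Set.ofPred_forall]
    exact isClosed_iInter fun g => isClosed_iInter fun h => isClosed_iInter fun k =>
      isClosed_iInter fun l => isClosed_eq (by fun_prop) (by fun_prop)
  have h2 : IsClosed {f : GaussianInt → ℕ → ℕ → UnitAddCircle |
      ∀ g k l, f (π₅ * g) (k + 1) l = f g k l} := by
    simp only [Set.ofPred_forall]
    exact isClosed_iInter fun g => isClosed_iInter fun k =>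
      isClosed_iInter fun l => isClosed_eq (by fun_prop) (by fun_prop)
  have h3 : IsClosed {f : GaussianInt → ℕ → ℕ → UnitAddCircle |
      ∀ g k l, f (π₁₃ * g) k (l + 1) = f g k l} := by
    simp only [Set.ofPred_forall]
    exact isClosed_iInter fun g => isClosed_iInter fun k =>
      isClosed_iInter fun l => isClosed_eq (by fun_prop) (by fun_prop)
  exact h1.inter (h2.inter h3)

theorem continuous_val (g : GaussianInt) (k l : ℕ) : Continuous fun x : Sol => x.1 g k l :=
  continuous_pi_iff.1 (continuous_pi_iff.1 (continuous_pi_iff.1 continuous_subtype_val g) k) l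

@[ext] theorem ext {x y : Sol} (h : ∀ g k l, x.1 g k l = y.1 g k l) : x = y :=
  Subtype.ext (funext fun g => funext fun k => funext fun l => h g k l)

@[simp] theorem add_val (x y : Sol) (g : GaussianInt) (k l : ℕ) :
    (x + y).1 g k l = x.1 g k l + y.1 g k l := rfl

@[simp] theorem sub_val (x y : Sol) (g : GaussianInt) (k l : ℕ) :
    (x - y).1 g k l = x.1 g k l - y.1 g k l := rfl

@[simp] theorem neg_val (x : Sol) (g : GaussianInt) (k l : ℕ) : (-x).1 g k l = -x.1 g k l := rfl

@[simp] theorem zero_val (g : GaussianInt) (k l : ℕ) : (0 : Sol).1 g k l = 0 := rfl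

@[simp] theorem nsmul_val (n : ℕ) (x : Sol) (g : GaussianInt) (k l : ℕ) :
    (n • x).1 g k l = n • x.1 g k l := rfl

/-- Precomposition of a character with multiplication by `(π̄₅ / π₅) ^ r * (π̄₁₃ / π₁₃) ^ s`. -/
def shift (r s : ℕ) : Sol →+ Sol :=
  AddMonoidHom.mk' (fun x => ⟨fun g k l => x.1 (star π₅ ^ r * star π₁₃ ^ s * g) (k + r) (l + s), by
    refine ⟨fun g h k l => ?_, fun g k l => ?_, fun g k l => ?_⟩
    · beta_reduce; rw [mul_add]; exact x.2.1 _ _ _ _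
    · beta_reduce; rw [mul_left_comm, add_right_comm]; exact x.2.2.1 _ _ _
    · beta_reduce; rw [mul_left_comm, add_right_comm]; exact x.2.2.2 _ _ _⟩) fun _ _ => rfl

theorem shift_val (r s : ℕ) (x : Sol) (g : GaussianInt) (k l : ℕ) :
    (shift r s x).1 g k l = x.1 (star π₅ ^ r * star π₁₃ ^ s * g) (k + r) (l + s) := rfl

theorem shift_shift (r s r' s' : ℕ) (x : Sol) :
    shift r s (shift r' s' x) = shift (r + r') (s + s') x := by
  ext g k l
  have h : star π₅ ^ r' * star π₁₃ ^ s' * (star π₅ ^ r * star π₁₃ ^ s * g) =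
      star π₅ ^ (r + r') * star π₁₃ ^ (s + s') * g := by ring
  rw [shift_val, shift_val, shift_val, h, add_assoc, add_assoc]

@[simp] theorem shift_zero_zero (x : Sol) : shift 0 0 x = x := by
  ext g k l
  simp [shift_val]

theorem continuous_shift (r s : ℕ) : Continuous (shift r s) := by
  refine Continuous.subtype_mk ?_ _
  exact continuous_pi fun g => continuous_pi fun k => continuous_pi fun l => continuous_val _ _ _

/-- The real characters `g / (π₅ ^ k * π₁₃ ^ l) ↦ Re (z g / (π₅ ^ k * π₁₃ ^ l))` modulo `1`. -/
noncomputable def flow : ℂ →+ Sol :=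
  AddMonoidHom.mk' (fun z => ⟨fun g k l =>
      ((z * toComplex g / (toComplex π₅ ^ k * toComplex π₁₃ ^ l)).re : UnitAddCircle), by
    have h5 := π₅_ne_zero
    have h13 := π₁₃_ne_zero
    refine ⟨fun g h k l => ?_, fun g k l => ?_, fun g k l => ?_⟩
    · beta_reduce; rw [← AddCircle.coe_add, ← add_re, toComplex_add, mul_add, add_div]
    · beta_reduce; rw [toComplex_mul, pow_succ]
      congr 2
      field_simp
    · beta_reduce; rw [toComplex_mul, pow_succ]
      congr 2
      field_simp⟩) fun z w => by
    ext g k l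
    simp only [add_val]
    rw [← AddCircle.coe_add, ← add_re, add_mul, add_div]

theorem flow_val (z : ℂ) (g : GaussianInt) (k l : ℕ) : (flow z).1 g k l =
    ((z * toComplex g / (toComplex π₅ ^ k * toComplex π₁₃ ^ l)).re : UnitAddCircle) := rfl

theorem shift_flow (r s : ℕ) (z : ℂ) : shift r s (flow z) = flow (rotMul r s * z) := by
  have h5 := π₅_ne_zero
  have h13 := π₁₃_ne_zero
  ext g k l
  rw [shift_val, flow_val, flow_val]
  congr 2
  simp only [toComplex_mul, map_pow, rotMul, rot, div_pow, pow_add]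
  field_simp

theorem flow_val_mult (z : ℂ) (r s : ℕ) :
    (flow z).1 (star π₅ ^ r * star π₁₃ ^ s) r s = ((rotMul r s * z).re : UnitAddCircle) := by
  have h := congrArg (fun x : Sol => x.1 1 0 0) (shift_flow r s z)
  simpa [shift_val, flow_val] using h

/-- The real character `flow z` is chosen to agree with `x` on `π₅⁻ᴹ π₁₃⁻ᴹ ℤ[i]`. -/
theorem eq_flow_add (x : Sol) (M : ℕ) : ∃ (z : ℂ) (κ : Sol), x = flow z + κ ∧
    (∀ g, κ.1 g M M = 0) ∧ ‖z‖ ≤ (‖x.1 1 M M‖ + ‖x.1 ⟨0, 1⟩ M M‖) *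
      ‖toComplex π₅ ^ M * toComplex π₁₃ ^ M‖ := by
  have h5 := π₅_ne_zero
  have h13 := π₁₃_ne_zero
  obtain ⟨w, hw, hwn⟩ := exists_eq_re_mul (Solenoid.hom x.2 M M)
  simp only [Solenoid.hom_apply] at hw hwn
  refine ⟨w * (toComplex π₅ ^ M * toComplex π₁₃ ^ M),
    x - flow (w * (toComplex π₅ ^ M * toComplex π₁₃ ^ M)), by abel, fun g => ?_, ?_⟩
  · rw [sub_val, flow_val, hw, sub_eq_zero]
    congr 2
    field_simp
  · rw [norm_mul]
    gcongr

/-- Near `0` the group is a product of a small disc of real characters and a group of characters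
that are trivial on a fine lattice. -/
theorem eventually_eq_flow_add (M : ℕ) {δ : ℝ} (hδ : 0 < δ) : ∀ᶠ x : Sol in 𝓝 0,
    ∃ (z : ℂ) (κ : Sol), x = flow z + κ ∧ (∀ g, κ.1 g M M = 0) ∧ ‖z‖ < δ := by
  have h1 : Tendsto (fun x : Sol => (‖x.1 1 M M‖ + ‖x.1 ⟨0, 1⟩ M M‖) *
      ‖toComplex π₅ ^ M * toComplex π₁₃ ^ M‖) (𝓝 0) (𝓝 0) := by
    have h2 : Continuous (fun x : Sol => (‖x.1 1 M M‖ + ‖x.1 ⟨0, 1⟩ M M‖) *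
      ‖toComplex π₅ ^ M * toComplex π₁₃ ^ M‖) :=
      (((continuous_val _ _ _).norm).add (continuous_val _ _ _).norm).mul continuous_const
    convert h2.tendsto 0 using 2
    simp
  filter_upwards [h1.eventually_lt_const hδ] with x hx
  obtain ⟨z, κ, h2, h3, h4⟩ := eq_flow_add x M
  exact ⟨z, κ, h2, h3, h4.trans_lt hx⟩

theorem flow_injective : Function.Injective flow := by
  rw [injective_iff_map_eq_zero]
  intro z hz
  have h5 := π₅_ne_zero
  have h13 := π₁₃_ne_zero
  have key : ∀ M : ℕ, ∃ y : GaussianInt, toComplex y = z / toComplex π₅ ^ M := fun M => by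
    refine exists_toComplex_eq fun x => ?_
    have h := congrArg (fun x : Sol => x.1) hz
    have h1 := congrFun (congrFun (congrFun h x) M) 0
    rw [flow_val] at h1
    rw [← show _ = (0 : UnitAddCircle) from h1]
    congr 2
    simp only [pow_zero, mul_one]
    ring
  have h6 : ‖toComplex π₅‖⁻¹ < 1 := by
    have h7 : Real.sqrt 1 < ‖toComplex π₅‖ := by
      rw [Complex.norm_def]
      apply Real.sqrt_lt_sqrt zero_le_one
      simp [Complex.normSq_apply, toComplex_def']
    rw [Real.sqrt_one] at h7
    exact inv_lt_one_of_one_lt₀ h7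
  have h8 := (tendsto_pow_atTop_nhds_zero_of_lt_one (by positivity) h6).const_mul ‖z‖
  rw [mul_zero] at h8
  obtain ⟨M, hM⟩ := (h8.eventually_lt_const one_pos).exists
  obtain ⟨y, hy⟩ := key M
  have h9 : ‖toComplex y‖ < 1 := by
    rw [hy]
    simpa [div_eq_mul_inv] using hM
  have h10 : y = 0 := by
    rw [← GaussianInt.norm_eq_zero]
    have h11 : ((y.norm : ℤ) : ℝ) < 1 := by
      rw [intCast_real_norm, Complex.normSq_eq_norm_sq]
      nlinarith [norm_nonneg (toComplex y)]
    have h12 : y.norm < 1 := by exact_mod_cast h11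
    have := GaussianInt.norm_nonneg y
    omega
  rw [h10, toComplex_zero] at hy
  rcases div_eq_zero_iff.1 hy.symm with h | h
  · exact h
  · exact absurd h (pow_ne_zero _ h5)

theorem eq_zero_of_le {κ : Sol} {M k l : ℕ} (h : ∀ g, κ.1 g M M = 0) (hk : k ≤ M) (hl : l ≤ M)
    (g : GaussianInt) : κ.1 g k l = 0 :=
  Solenoid.eq_zero_of_le κ.2 h hk hl g

/-- The multiples, under the two multipliers, of a nonzero character that is trivial on a
sufficiently fine lattice approximate any given character on a coarse lattice; this is possible with
multipliers close to `1` and exponents divisible by given numbers. -/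
theorem spread {a b : ℕ} (ha : a ≠ 0) (hb : b ≠ 0) (m : ℕ) {δ : ℝ} (hδ : 0 < δ) :
    ∃ M : ℕ, ∀ κ : Sol, (∀ g, κ.1 g M M = 0) → κ ≠ 0 → ∀ d : Sol, ∃ r s : ℕ, a ∣ r ∧ b ∣ s ∧
      ‖rotMul r s - 1‖ < δ ∧ ∃ w : ℂ, ‖w‖ < δ ∧
        ∀ x, (shift r s κ).1 x m m = d.1 x m m + ((w * toComplex x).re : UnitAddCircle) := by
  obtain ⟨M₁, h₁⟩ := Solenoid.spread_left splitPair_five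
    (fun _ hn => splitPair_thirteen.star_pow_ne hn) splitPair_thirteen.ne_zero ha hb m hδ
  obtain ⟨M₂, h₂⟩ := Solenoid.spread_left splitPair_thirteen
    (fun _ hn => splitPair_five.star_pow_ne hn) splitPair_five.ne_zero hb ha m hδ
  refine ⟨max M₁ M₂, fun κ hκ hne d => ?_⟩
  obtain ⟨v, hv, -⟩ := exists_eq_re_mul (Solenoid.hom d.2 m m)
  have hw : ∀ w : ℂ, ∀ x, ((w * toComplex x).re : UnitAddCircle) =
      d.1 x m m + (((w - v) * toComplex x).re : UnitAddCircle) := fun w x => by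
    rw [← Solenoid.hom_apply d.2, hv, ← AddCircle.coe_add, ← add_re]
    congr 2
    ring
  have hpq := splitPair_five.isCoprime_of_not_dvd splitPair_five.not_dvd
  have hcase : (∃ g k, κ.1 g k 0 ≠ 0) ∨ ∃ g l, κ.1 g 0 l ≠ 0 := by
    by_contra! hcon
    exact hne (ext fun g k l => Solenoid.eq_zero_of_isCoprime κ.2 hpq (fun g => hcon.1 g k)
      (fun g => hcon.2 g l) g)
  rcases hcase with hc | hc
  · obtain ⟨r, s, hr, hs, hrs, w, hwv, hx⟩ :=
      h₁ κ.1 κ.2 (eq_zero_of_le hκ (le_max_left _ _) (le_max_left _ _)) hc v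
    exact ⟨r, s, hr, hs, hrs, w - v, hwv, fun x => by rw [shift_val, hx, hw]⟩
  · obtain ⟨s, r, hs, hr, hrs, w, hwv, hx⟩ :=
      h₂ _ (Solenoid.swap κ.2) (eq_zero_of_le hκ (le_max_right _ _) (le_max_right _ _)) hc v
    refine ⟨r, s, hr, hs, by rwa [rotMul, mul_comm], w - v, hwv, fun x => ?_⟩
    rw [shift_val, mul_comm (star π₅ ^ r), hx, hw]

/-! ### Differences in closed invariant sets -/

theorem one_le_norm_π₅ : 1 ≤ ‖toComplex π₅‖ := by
  rw [Complex.norm_def, Real.one_le_sqrt]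
  simp [Complex.normSq_apply, toComplex_def']

theorem one_le_norm_π₁₃ : 1 ≤ ‖toComplex π₁₃‖ := by
  rw [Complex.norm_def, Real.one_le_sqrt]
  simp [Complex.normSq_apply, toComplex_def']
  norm_num

/-- Convergence in the group of characters is implied by sufficiently rapid uniform convergence on
an increasing sequence of lattices. -/
theorem tendsto_of_val {e : ℕ → Sol} {d : Sol}
    (h : ∀ m : ℕ, ∃ w : ℂ, ‖w‖ * (‖toComplex π₅‖ ^ m * ‖toComplex π₁₃‖ ^ m) ≤ 1 / ((m : ℝ) + 1) ∧
      ∀ x, (e m).1 x m m = d.1 x m m + ((w * toComplex x).re : UnitAddCircle)) :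
    Tendsto e atTop (𝓝 d) := by
  rw [tendsto_subtype_rng, tendsto_pi_nhds]
  intro g
  rw [tendsto_pi_nhds]
  intro k
  rw [tendsto_pi_nhds]
  intro l
  rw [tendsto_iff_norm_sub_tendsto_zero]
  have h1 := (tendsto_one_div_add_atTop_nhds_zero_nat (𝕜 := ℝ)).mul_const ‖toComplex g‖
  rw [zero_mul] at h1
  refine squeeze_zero' (Eventually.of_forall fun _ => norm_nonneg _) ?_ h1
  filter_upwards [eventually_ge_atTop (max k l)] with m hm
  obtain ⟨w, hw, hx⟩ := h m
  have h2 : ∀ y : Sol, y.1 g k l = y.1 (π₁₃ ^ (m - l) * (π₅ ^ (m - k) * g)) m m := fun y => by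
    have hk : k + (m - k) = m := Nat.add_sub_cancel' ((le_max_left _ _).trans hm)
    have hl : l + (m - l) = m := Nat.add_sub_cancel' ((le_max_right _ _).trans hm)
    have h3 := Solenoid.pow_mul_right y.2 (m - l) (π₅ ^ (m - k) * g) m l
    have h4 := Solenoid.pow_mul_left y.2 (m - k) g k l
    rw [hl] at h3
    rw [hk] at h4
    rw [h3, h4]
  rw [h2 (e m), h2 d, hx, add_sub_cancel_left]
  refine (norm_coe_re_mul_le _ _).trans ?_
  rw [toComplex_mul, toComplex_mul, norm_mul, norm_mul, map_pow, map_pow, norm_pow, norm_pow]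
  have h5 := pow_le_pow_right₀ one_le_norm_π₅ (Nat.sub_le m k)
  have h13 := pow_le_pow_right₀ one_le_norm_π₁₃ (Nat.sub_le m l)
  calc ‖w‖ * (‖toComplex π₁₃‖ ^ (m - l) * (‖toComplex π₅‖ ^ (m - k) * ‖toComplex g‖))
      ≤ ‖w‖ * (‖toComplex π₁₃‖ ^ m * (‖toComplex π₅‖ ^ m * ‖toComplex g‖)) := by gcongr
    _ = ‖w‖ * (‖toComplex π₅‖ ^ m * ‖toComplex π₁₃‖ ^ m) * ‖toComplex g‖ := by ring
    _ ≤ 1 / ((m : ℝ) + 1) * ‖toComplex g‖ := by gcongr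

/-- A set of characters is invariant for the exponents `a`, `b` if it is stable under
multiplication by `(π̄₅ / π₅) ^ r * (π̄₁₃ / π₁₃) ^ s` whenever `a ∣ r` and `b ∣ s`. -/
def IsInv (a b : ℕ) (Z : Set Sol) : Prop :=
  ∀ r s, a ∣ r → b ∣ s → ∀ x ∈ Z, shift r s x ∈ Z

/-- A character whose orbit under each of the two multipliers is eventually periodic up to real
characters. -/
def IsPreperiodic (x : Sol) : Prop :=
  (∃ i j : ℕ, i < j ∧ ∃ z : ℂ, shift i 0 x - shift j 0 x = flow z) ∧
    ∃ i j : ℕ, i < j ∧ ∃ z : ℂ, shift 0 i x - shift 0 j x = flow z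

theorem exists_sub_mem (u : ℕ → Sol) {V : Set Sol} (hV : V ∈ 𝓝 (0 : Sol)) :
    ∃ i j : ℕ, i < j ∧ u i - u j ∈ V := by
  obtain ⟨y, hy⟩ := exists_clusterPt_of_compactSpace (map u atTop)
  have hc : ContinuousAt (fun t : Sol × Sol => t.1 - t.2) (y, y) :=
    (continuous_fst.sub continuous_snd).continuousAt
  have h1 : (fun t : Sol × Sol => t.1 - t.2) ⁻¹' V ∈ 𝓝 (y, y) := hc (by simpa using hV)
  rw [nhds_prod_eq] at h1
  obtain ⟨W, hW, hWV⟩ := mem_prod_same_iff.1 h1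
  have hf : ∃ᶠ n in atTop, u n ∈ W := (show MapClusterPt y atTop u from hy).frequently hW
  obtain ⟨i, hi⟩ := hf.exists
  obtain ⟨j, hj, hij⟩ := (hf.and_eventually (eventually_gt_atTop i)).exists
  exact ⟨i, j, hij, hWV (Set.mk_mem_prod hi hj)⟩

/-- In an invariant set without preperiodic points, there are pairs of points that differ by a small
real character and a nonzero character trivial on a fine lattice. -/
theorem exists_sub_eq_flow_add {a b : ℕ} (ha : a ≠ 0) (hb : b ≠ 0) {Z : Set Sol}
    (hne : Z.Nonempty) (hinv : IsInv a b Z) (hper : ∀ x ∈ Z, ¬ IsPreperiodic x) (M : ℕ) {δ : ℝ}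
    (hδ : 0 < δ) : ∃ x ∈ Z, ∃ y ∈ Z, ∃ (z : ℂ) (κ : Sol), y - x = flow z + κ ∧
      (∀ g, κ.1 g M M = 0) ∧ ‖z‖ < δ ∧ κ ≠ 0 := by
  obtain ⟨x, hx⟩ := hne
  have key : ∀ u : ℕ → Sol, (∀ n, u n ∈ Z) → (∀ i j, i < j → ∀ z, u i - u j ≠ flow z) →
      ∃ x ∈ Z, ∃ y ∈ Z, ∃ (z : ℂ) (κ : Sol), y - x = flow z + κ ∧
        (∀ g, κ.1 g M M = 0) ∧ ‖z‖ < δ ∧ κ ≠ 0 := by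
    intro u hu hne
    obtain ⟨i, j, hij, z, κ, h1, h2, h3⟩ := exists_sub_mem u (eventually_eq_flow_add M hδ)
    refine ⟨u j, hu j, u i, hu i, z, κ, h1, h2, h3, ?_⟩
    rintro rfl
    exact hne i j hij z (by rw [h1, add_zero])
  have h1 := hper x hx
  rw [IsPreperiodic, not_and_or] at h1
  rcases h1 with h1 | h1
  · refine key (fun n => shift (a * n) 0 x)
      (fun n => hinv _ _ (Dvd.intro _ rfl) (dvd_zero _) x hx) fun i j hij z hz => h1 ?_
    exact ⟨a * i, a * j, Nat.mul_lt_mul_of_pos_left hij (Nat.pos_of_ne_zero ha), z, hz⟩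
  · refine key (fun n => shift 0 (b * n) x)
      (fun n => hinv _ _ (dvd_zero _) (Dvd.intro _ rfl) x hx) fun i j hij z hz => h1 ?_
    exact ⟨b * i, b * j, Nat.mul_lt_mul_of_pos_left hij (Nat.pos_of_ne_zero hb), z, hz⟩

/-- Every character is a difference of two members of a closed invariant set without preperiodic
points. -/
theorem exists_add_mem {a b : ℕ} (ha : a ≠ 0) (hb : b ≠ 0) {Z : Set Sol} (hcl : IsClosed Z)
    (hne : Z.Nonempty) (hinv : IsInv a b Z) (hper : ∀ x ∈ Z, ¬ IsPreperiodic x) (d : Sol) :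
    ∃ x ∈ Z, x + d ∈ Z := by
  have h5 := π₅_ne_zero
  have h13 := π₁₃_ne_zero
  have hD : IsClosed ((fun t : Sol × Sol => t.2 - t.1) '' (Z ×ˢ Z)) :=
    ((hcl.isCompact.prod hcl.isCompact).image (continuous_snd.sub continuous_fst)).isClosed
  have key : ∀ m : ℕ, ∃ e ∈ (fun t : Sol × Sol => t.2 - t.1) '' (Z ×ˢ Z), ∃ w : ℂ,
      ‖w‖ * (‖toComplex π₅‖ ^ m * ‖toComplex π₁₃‖ ^ m) ≤ 1 / ((m : ℝ) + 1) ∧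
        ∀ x, e.1 x m m = d.1 x m m + ((w * toComplex x).re : UnitAddCircle) := by
    intro m
    set D := ‖toComplex π₅‖ ^ m * ‖toComplex π₁₃‖ ^ m with hDdef
    have hDpos : 0 < D := by positivity
    have hD1 : 1 ≤ D := one_le_mul_of_one_le_of_one_le (one_le_pow₀ one_le_norm_π₅)
      (one_le_pow₀ one_le_norm_π₁₃)
    obtain ⟨δ, hδ, hδD⟩ : ∃ δ : ℝ, 0 < δ ∧ (δ + δ) * D = 1 / ((m : ℝ) + 1) :=
      ⟨1 / ((m : ℝ) + 1) / D / 2, by positivity, by field_simp; norm_num⟩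
    obtain ⟨M, hM⟩ := spread ha hb m hδ
    obtain ⟨x, hx, y, hy, z, κ, hyx, hκ, hz, hκ0⟩ :=
      exists_sub_eq_flow_add ha hb hne hinv hper M hδ
    obtain ⟨r, s, hr, hs, -, w, hw, hval⟩ := hM κ hκ hκ0 d
    refine ⟨shift r s y - shift r s x,
      ⟨(shift r s x, shift r s y), ⟨hinv r s hr hs x hx, hinv r s hr hs y hy⟩, rfl⟩,
      rotMul r s * z / (toComplex π₅ ^ m * toComplex π₁₃ ^ m) + w, ?_, fun g => ?_⟩
    · rw [← hδD]
      gcongr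
      refine (norm_add_le _ _).trans (add_le_add ?_ hw.le)
      rw [norm_div, norm_mul, norm_rotMul, one_mul, norm_mul, norm_pow, norm_pow]
      exact (div_le_self (norm_nonneg _) hD1).trans hz.le
    · rw [← map_sub, hyx, map_add, shift_flow, add_val, hval, flow_val, add_left_comm,
        ← AddCircle.coe_add, ← add_re]
      congr 3
      ring
  choose e heD he using key
  obtain ⟨⟨x, y⟩, ⟨hx, hy⟩, hxy⟩ := hD.mem_of_tendsto (tendsto_of_val he) (Eventually.of_forall heD)
  refine ⟨x, hx, ?_⟩
  have h1 : x + d = y := by rw [← hxy]; simp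
  rwa [h1]

/-! ### Periodic characters of order a power of two -/

theorem flow_val_eq_zero {z : ℂ} {g : GaussianInt} {k l : ℕ} (y : GaussianInt)
    (h : z * toComplex g = toComplex y * (toComplex π₅ ^ k * toComplex π₁₃ ^ l)) :
    (flow z).1 g k l = 0 := by
  have h5 := π₅_ne_zero
  have h13 := π₁₃_ne_zero
  rw [flow_val, h, mul_div_assoc, div_self (by positivity), mul_one, coe_re_toComplex]

/-- A character of order `2 ^ (j + 1)` that is invariant under the `2 ^ j`-th powers of the
multipliers. It is a limit of real characters `flow z`, with `z = (π₅ π₁₃) ^ m / 2 ^ (j + 1)`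
and `m` divisible by higher and higher powers. -/
theorem exists_dyadic (j : ℕ) : ∃ d : Sol, d.1 1 0 0 = ((1 / 2 ^ (j + 1) : ℝ) : UnitAddCircle) ∧
    shift (2 ^ j) 0 d = d ∧ shift 0 (2 ^ j) d = d := by
  have h5 := π₅_ne_zero
  have h13 := π₁₃_ne_zero
  have hpow : ∀ X Y : GaussianInt, (2 : GaussianInt) ∣ X - Y → ∃ h : GaussianInt,
      X ^ 2 ^ j - Y ^ 2 ^ j = 2 ^ (j + 1) * h := fun X Y h => by
    have h2 := dvd_sub_pow_of_dvd_sub (p := 2) (a := X) (b := Y) (by exact_mod_cast h) j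
    exact_mod_cast h2
  obtain ⟨h₁, hh₁⟩ := hpow (star π₅) π₅ ⟨⟨0, 2⟩, by ext <;> simp⟩
  obtain ⟨h₂, hh₂⟩ := hpow (star π₁₃) π₁₃ ⟨⟨0, 3⟩, by ext <;> simp⟩
  obtain ⟨h₃, hh₃⟩ := hpow ((π₅ * π₁₃) ^ 2) 1 ⟨⟨-17, 28⟩, by ext <;> simp [pow_two]⟩
  set u : ℕ → Sol := fun m => flow (toComplex (π₅ * π₁₃) ^ (2 * 2 ^ j * m) / 2 ^ (j + 1)) with hu
  obtain ⟨d, hd⟩ := exists_clusterPt_of_compactSpace (map u atTop)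
  have hcl : ∀ C : Set Sol, IsClosed C → (∀ᶠ m in atTop, u m ∈ C) → d ∈ C := fun C hC h => by
    by_contra hdC
    obtain ⟨m, h1, h2⟩ := (((show MapClusterPt d atTop u from hd).frequently
      (hC.isOpen_compl.mem_nhds hdC)).and_eventually h).exists
    exact h1 h2
  have hle : ∀ n : ℕ, ∀ᶠ m in atTop, n ≤ 2 * 2 ^ j * m := fun n => by
    filter_upwards [eventually_ge_atTop n] with m hm
    exact hm.trans (Nat.le_mul_of_pos_left m (by positivity))
  refine ⟨d, ?_, ?_, ?_⟩
  · refine hcl {x | x.1 1 0 0 = ((1 / 2 ^ (j + 1) : ℝ) : UnitAddCircle)}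
      (isClosed_eq (continuous_val _ _ _) continuous_const) (Eventually.of_forall fun m => ?_)
    obtain ⟨h₄, hh₄⟩ : ∃ h : GaussianInt,
        (π₅ * π₁₃) ^ (2 * 2 ^ j * m) = 1 + 2 ^ (j + 1) * h := by
      have h4 := sub_dvd_pow_sub_pow (((π₅ * π₁₃) ^ 2) ^ 2 ^ j) (1 ^ 2 ^ j) m
      obtain ⟨h, hh⟩ := (Dvd.intro _ hh₃.symm).trans h4
      refine ⟨h, ?_⟩
      rw [← hh, pow_mul, pow_mul]
      simp
    have h6 := congrArg toComplex hh₄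
    simp only [map_pow, map_add, map_mul, map_one, map_ofNat] at h6
    have h7 : (1 / 2 ^ (j + 1) : ℝ) = ((1 / 2 ^ (j + 1) : ℂ)).re := by
      rw [← Complex.ofReal_re (1 / 2 ^ (j + 1))]; push_cast; rfl
    simp only [Set.mem_ofPred_eq, hu, flow_val]
    have h8 : toComplex (π₅ * π₁₃) ^ (2 * 2 ^ j * m) / 2 ^ (j + 1) * toComplex 1 /
        (toComplex π₅ ^ 0 * toComplex π₁₃ ^ 0) = 1 / 2 ^ (j + 1) + toComplex h₄ := by
      rw [toComplex_mul, h6]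
      field_simp
      simp
    rw [h8, add_re, AddCircle.coe_add, coe_re_toComplex, add_zero, h7]
  · ext g k l
    refine hcl {x | (shift (2 ^ j) 0 x).1 g k l = x.1 g k l}
      (isClosed_eq ((continuous_val _ _ _).comp (continuous_shift _ _)) (continuous_val _ _ _)) ?_
    filter_upwards [hle (2 ^ j + k), hle l] with m hm hm'
    simp only [hu]
    rw [← sub_eq_zero, ← sub_val, shift_flow, ← map_sub]
    obtain ⟨n, hn⟩ := Nat.exists_eq_add_of_le hm
    obtain ⟨n', hn'⟩ := Nat.exists_eq_add_of_le hm'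
    refine flow_val_eq_zero (π₅ ^ n * π₁₃ ^ n' * h₁ * g) ?_
    have h6 := congrArg toComplex hh₁
    simp only [map_pow, map_sub, map_mul, map_ofNat] at h6
    have h7 : toComplex (star π₅) ^ 2 ^ j = toComplex π₅ ^ 2 ^ j + 2 ^ (j + 1) * toComplex h₁ := by
      rw [← h6]; ring
    rw [toComplex_mul, mul_pow, rotMul, rot, div_pow, h7]
    nth_rewrite 1 [hn]
    nth_rewrite 1 [hn']
    nth_rewrite 1 [hn]
    nth_rewrite 1 [hn']
    simp only [toComplex_mul, map_pow, pow_add]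
    field_simp
    ring
  · ext g k l
    refine hcl {x | (shift 0 (2 ^ j) x).1 g k l = x.1 g k l}
      (isClosed_eq ((continuous_val _ _ _).comp (continuous_shift _ _)) (continuous_val _ _ _)) ?_
    filter_upwards [hle k, hle (2 ^ j + l)] with m hm hm'
    simp only [hu]
    rw [← sub_eq_zero, ← sub_val, shift_flow, ← map_sub]
    obtain ⟨n, hn⟩ := Nat.exists_eq_add_of_le hm
    obtain ⟨n', hn'⟩ := Nat.exists_eq_add_of_le hm'
    refine flow_val_eq_zero (π₅ ^ n * π₁₃ ^ n' * h₂ * g) ?_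
    have h6 := congrArg toComplex hh₂
    simp only [map_pow, map_sub, map_mul, map_ofNat] at h6
    have h7 : toComplex (star π₁₃) ^ 2 ^ j = toComplex π₁₃ ^ 2 ^ j + 2 ^ (j + 1) * toComplex h₂ := by
      rw [← h6]; ring
    rw [toComplex_mul, mul_pow, rotMul, rot, rot, div_pow, div_pow, h7]
    nth_rewrite 1 [hn]
    nth_rewrite 1 [hn']
    nth_rewrite 1 [hn]
    nth_rewrite 1 [hn']
    simp only [toComplex_mul, map_pow, pow_add]
    field_simp
    ring

/-! ### Characters avoiding a neighbourhood of zero -/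

/-- The characters all of whose values at the multipliers are at distance at least `ε` from `0`. -/
def avoiding (ε : ℝ) : Set Sol := {x | ∀ r s, ε ≤ ‖x.1 (star π₅ ^ r * star π₁₃ ^ s) r s‖}

theorem isClosed_avoiding (ε : ℝ) : IsClosed (avoiding ε) := by
  simp only [avoiding, Set.ofPred_forall]
  exact isClosed_iInter fun r => isClosed_iInter fun s =>
    isClosed_le continuous_const (continuous_val _ _ _).norm

theorem shift_val_mult (r s r' s' : ℕ) (x : Sol) :
    (shift r s x).1 (star π₅ ^ r' * star π₁₃ ^ s') r' s' =
      x.1 (star π₅ ^ (r + r') * star π₁₃ ^ (s + s')) (r + r') (s + s') := by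
  have h : star π₅ ^ r * star π₁₃ ^ s * (star π₅ ^ r' * star π₁₃ ^ s') =
      star π₅ ^ (r + r') * star π₁₃ ^ (s + s') := by ring
  rw [shift_val, h, add_comm r', add_comm s']

theorem isInv_avoiding (ε : ℝ) : IsInv 1 1 (avoiding ε) := fun r s _ _ x hx r' s' => by
  rw [shift_val_mult]
  exact hx _ _

theorem shift_mul_eq_self {d : Sol} {a b : ℕ} (ha : shift a 0 d = d) (hb : shift 0 b d = d)
    {r s : ℕ} (hr : a ∣ r) (hs : b ∣ s) : shift r s d = d := by
  obtain ⟨i, rfl⟩ := hr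
  obtain ⟨k, rfl⟩ := hs
  have h1 : ∀ i, shift (a * i) 0 d = d := fun i => by
    induction i with
    | zero => simp
    | succ i ih => rw [mul_add, mul_one, ← add_zero 0, ← shift_shift, ha, ih]
  have h2 : ∀ i, shift 0 (b * i) d = d := fun i => by
    induction i with
    | zero => simp
    | succ i ih => rw [mul_add, mul_one, ← add_zero 0, ← shift_shift, hb, ih]
  have h3 := shift_shift (a * i) 0 0 (b * k) d
  rw [h2, h1, add_zero, zero_add] at h3
  exact h3.symm

/-- Furstenberg's argument: a closed invariant set of characters avoiding a neighbourhood of zero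
contains a preperiodic character. Otherwise it would contain a progression
`x, x + d, …, x + N d` for a periodic character `d` of large order `N`. -/
theorem exists_isPreperiodic {ε : ℝ} (hε : 0 < ε) {Z : Set Sol} (hcl : IsClosed Z)
    (hne : Z.Nonempty) (hinv : IsInv 1 1 Z) (hZ : Z ⊆ avoiding ε) : ∃ x ∈ Z, IsPreperiodic x := by
  by_contra! hper
  obtain ⟨j, hj⟩ : ∃ j : ℕ, (1 / 2 : ℝ) ^ j < ε := exists_pow_lt_of_lt_one hε (by norm_num)
  obtain ⟨d, hd1, hd2, hd3⟩ := exists_dyadic j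
  have hj0 : 2 ^ j ≠ 0 := by positivity
  have hprog : ∀ n : ℕ, ∃ x, ∀ i ≤ n, x + i • d ∈ Z := by
    intro n
    induction n with
    | zero =>
      obtain ⟨x, hx⟩ := hne
      refine ⟨x, fun i hi => ?_⟩
      obtain rfl : i = 0 := by omega
      simpa using hx
    | succ n ih =>
      have hcl' : IsClosed {x : Sol | ∀ i ≤ n, x + i • d ∈ Z} := by
        simp only [Set.ofPred_forall]
        exact isClosed_iInter fun i => isClosed_iInter fun _ =>
          hcl.preimage (continuous_add_const (i • d))
      obtain ⟨x, hx, hxd⟩ := exists_add_mem hj0 hj0 hcl' ih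
        (fun r s hr hs x hx i hi => by
          have h1 := hinv r s (one_dvd _) (one_dvd _) _ (hx i hi)
          rwa [map_add, map_nsmul, shift_mul_eq_self hd2 hd3 hr hs] at h1)
        (fun x hx => hper x (by simpa using hx 0 (Nat.zero_le _))) d
      refine ⟨x, fun i hi => ?_⟩
      rcases Nat.eq_zero_or_pos i with rfl | hi0
      · exact hx 0 (Nat.zero_le _)
      · obtain ⟨i, rfl⟩ : ∃ i', i = i' + 1 := ⟨i - 1, by omega⟩
        have h1 := hxd i (by omega)
        rwa [add_assoc, ← succ_nsmul'] at h1
  obtain ⟨x, hx⟩ := hprog (2 ^ (j + 1))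
  -- A suitable multiple of `1 / 2 ^ (j + 1)` is close to `- x 1`.
  obtain ⟨u, hu⟩ := QuotientAddGroup.mk_surjective (x.1 1 0 0)
  have hN : (0 : ℝ) < 2 ^ (j + 1) := by positivity
  set v := Int.fract (-u) with hv
  set i := ⌊v * 2 ^ (j + 1)⌋₊ with hi
  have hv0 : 0 ≤ v := Int.fract_nonneg _
  have hv1 : v < 1 := Int.fract_lt_one _
  have hiN : i ≤ 2 ^ (j + 1) := by
    apply Nat.floor_le_of_le
    push_cast
    nlinarith
  have h1 := hZ (hx i hiN) 0 0
  have h2 : (x + i • d).1 (star π₅ ^ 0 * star π₁₃ ^ 0) 0 0 =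
      ((i * (1 / 2 ^ (j + 1)) - v : ℝ) : UnitAddCircle) := by
    rw [pow_zero, pow_zero, mul_one, add_val, nsmul_val, hd1, ← hu, ← AddCircle.coe_nsmul,
      ← sub_eq_zero]
    change ((u : ℝ) : UnitAddCircle) + _ - _ = 0
    rw [← AddCircle.coe_add, ← AddCircle.coe_sub]
    refine coe_eq_zero_of_int (-⌊-u⌋) ?_
    rw [hv, Int.fract, nsmul_eq_mul]
    push_cast
    ring
  rw [h2] at h1
  have h3 := norm_coe_le_abs (i * (1 / 2 ^ (j + 1)) - v)
  have h4 : |(i : ℝ) * (1 / 2 ^ (j + 1)) - v| ≤ (1 / 2) ^ j := by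
    have h5 : (i : ℝ) ≤ v * 2 ^ (j + 1) := Nat.floor_le (by positivity)
    have h6 : v * 2 ^ (j + 1) < i + 1 := Nat.lt_floor_add_one _
    have h7 : (i : ℝ) * (1 / 2 ^ (j + 1)) - v = (i - v * 2 ^ (j + 1)) / 2 ^ (j + 1) := by
      field_simp
    rw [h7, abs_div, abs_of_pos hN, div_le_iff₀ hN]
    have h8 : ((1 : ℝ) / 2) ^ j * 2 ^ (j + 1) = 2 := by
      rw [pow_succ, ← mul_assoc, ← mul_pow]; norm_num
    rw [h8, abs_le]
    constructor <;> linarith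
  linarith

/-! ### Accumulation points and the structure of avoiding characters -/

theorem rotMul_sub_ne_zero {i j : ℕ} (hij : i < j) : rotMul i 0 - rotMul j 0 ≠ 0 := by
  obtain ⟨n, rfl⟩ := Nat.exists_eq_add_of_lt hij
  have h1 : rotMul i 0 ≠ 0 := by
    rw [← norm_ne_zero_iff, norm_rotMul]; exact one_ne_zero
  have h2 : rotMul (i + n + 1) 0 = rotMul i 0 * rot π₅ ^ (n + 1) := by
    simp only [rotMul, add_assoc, pow_add]; ring
  intro h
  rw [h2, sub_eq_zero, eq_comm, mul_eq_left₀ h1] at h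
  exact rot_pow_ne_one splitPair_five.ne_zero
    (splitPair_five.star_pow_ne (Nat.succ_ne_zero n)) h

/-- Some multiple of a preperiodic character is the sum of a real character and a periodic one. -/
theorem IsPreperiodic.exists_shift_eq {x : Sol} (h : IsPreperiodic x) :
    ∃ (u u' : ℕ) (c : ℂ) (τ : Sol) (a b : ℕ), a ≠ 0 ∧ b ≠ 0 ∧ shift u u' x = flow c + τ ∧
      shift a 0 τ = τ ∧ shift 0 b τ = τ := by
  obtain ⟨⟨i, j, hij, z, hz⟩, i', j', hij', z', hz'⟩ := h
  have hne := rotMul_sub_ne_zero hij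
  set c := z / (rotMul i 0 - rotMul j 0) with hc
  set τ := x - flow c with hτ
  have hA : shift i 0 τ = shift j 0 τ := by
    rw [← sub_eq_zero]
    have h1 : shift i 0 τ - shift j 0 τ =
        (shift i 0 x - shift j 0 x) - flow ((rotMul i 0 - rotMul j 0) * c) := by
      rw [sub_mul, map_sub flow, hτ, map_sub, map_sub, shift_flow, shift_flow]; abel
    rw [h1, hz, hc, mul_div_cancel₀ _ hne, sub_self]
  obtain ⟨z₂, hz₂⟩ : ∃ z₂, shift 0 i' τ - shift 0 j' τ = flow z₂ := by
    refine ⟨z' - (rotMul 0 i' - rotMul 0 j') * c, ?_⟩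
    rw [map_sub flow, ← hz', sub_mul, map_sub flow, hτ, map_sub, map_sub, shift_flow, shift_flow]
    abel
  -- The real character `flow z₂` is annihilated by `shift i 0 - shift j 0`, hence trivial.
  have hz₂0 : z₂ = 0 := by
    have h1 : flow ((rotMul i 0 - rotMul j 0) * z₂) = 0 := by
      rw [sub_mul, map_sub, ← shift_flow, ← shift_flow, ← hz₂, map_sub (shift i 0) (shift 0 i' τ),
        map_sub (shift j 0) (shift 0 i' τ)]
      have h2 : ∀ n, shift i 0 (shift 0 n τ) = shift j 0 (shift 0 n τ) := fun n => by
        have h3 : ∀ k, shift k 0 (shift 0 n τ) = shift 0 n (shift k 0 τ) := fun k => by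
          simp only [shift_shift, add_zero, zero_add]
        rw [h3, h3, hA]
      rw [h2, h2, sub_self]
    rw [← map_zero flow] at h1
    exact (mul_eq_zero.1 (flow_injective h1)).resolve_left hne
  have hB : shift 0 i' τ = shift 0 j' τ := by
    rw [← sub_eq_zero, hz₂, hz₂0, map_zero]
  refine ⟨i, i', rotMul i i' * c, shift i i' τ, j - i, j' - i', by omega, by omega, ?_, ?_, ?_⟩
  · rw [← shift_flow, ← map_add, hτ, add_sub_cancel]
  · rw [shift_shift, zero_add, Nat.sub_add_cancel hij.le]
    have h1 := congrArg (shift 0 i') hA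
    simpa [shift_shift] using h1.symm
  · rw [shift_shift, zero_add, Nat.sub_add_cancel hij'.le]
    have h1 := congrArg (shift i 0) hB
    simpa [shift_shift] using h1.symm

/-- A nonzero character trivial on `ℤ[i]` stays nonzero under the multipliers: the numerators
`π̄₅` and `π̄₁₃` are coprime to the denominators. -/
theorem shift_ne_zero {κ : Sol} (h0 : ∀ g, κ.1 g 0 0 = 0) (hκ : κ ≠ 0) (r s : ℕ) :
    shift r s κ ≠ 0 := by
  intro hs
  refine hκ (ext fun g k l => ?_)
  have hcop : IsCoprime (star π₅ ^ r * star π₁₃ ^ s) (π₅ ^ k * π₁₃ ^ l) := by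
    have h1 := splitPair_five.isCoprime_of_not_dvd splitPair_five.not_dvd_star
    have h2 := splitPair_five.isCoprime_of_not_dvd splitPair_five.not_dvd_star'
    have h3 := splitPair_thirteen.isCoprime_of_not_dvd splitPair_thirteen.not_dvd_star
    have h4 := splitPair_thirteen.isCoprime_of_not_dvd splitPair_thirteen.not_dvd_star'
    exact IsCoprime.symm <| (h1.pow.mul_right h2.pow).mul_left (h4.pow.mul_right h3.pow)
  obtain ⟨α, β, hαβ⟩ := hcop
  have hg : g = star π₅ ^ r * star π₁₃ ^ s * (α * g) + π₁₃ ^ l * (π₅ ^ k * (β * g)) := by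
    linear_combination (-g) * hαβ
  have h1 := Solenoid.pow_mul_right κ.2 l (π₅ ^ k * (β * g)) k 0
  have h2 := Solenoid.pow_mul_left κ.2 k (β * g) 0 0
  rw [zero_add] at h1 h2
  have h3 := Solenoid.pow_mul_right κ.2 s (π₅ ^ r * (star π₅ ^ r * star π₁₃ ^ s * (α * g))) (k + r) l
  have h4 := Solenoid.pow_mul_left κ.2 r (star π₅ ^ r * star π₁₃ ^ s * (α * g)) k l
  have h5 := shift_val r s κ (π₁₃ ^ s * (π₅ ^ r * (α * g))) k l
  have h6 : star π₅ ^ r * star π₁₃ ^ s * (π₁₃ ^ s * (π₅ ^ r * (α * g))) =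
      π₁₃ ^ s * (π₅ ^ r * (star π₅ ^ r * star π₁₃ ^ s * (α * g))) := by ring
  rw [hs, zero_val, h6, h3, h4] at h5
  rw [hg, Solenoid.map_add' κ.2, ← h5, h1, h2, h0, zero_val, add_zero]

/-- The avoiding characters that are approximated by avoiding characters in a direction other than
that of the real characters. -/
def transverse (ε : ℝ) : Set Sol := {x | x ∈ avoiding ε ∧ ∀ (M : ℕ) (δ : ℝ), 0 < δ →
  ∃ (z : ℂ) (κ : Sol), x + flow z + κ ∈ avoiding ε ∧ (∀ g, κ.1 g M M = 0) ∧ ‖z‖ < δ ∧ κ ≠ 0}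

theorem isClosed_transverse (ε : ℝ) : IsClosed (transverse ε) := by
  refine isClosed_of_closure_subset fun x hx => ⟨?_, fun M δ hδ => ?_⟩
  · exact closure_minimal (fun y hy => hy.1) (isClosed_avoiding ε) hx
  · rw [mem_closure_iff_frequently] at hx
    have ht : Tendsto (fun y : Sol => y - x) (𝓝 x) (𝓝 0) := by
      have h1 : Continuous fun y : Sol => y - x := continuous_sub_right x
      simpa using h1.tendsto x
    obtain ⟨y, hy, z, κ, hyx, hκ, hz⟩ :=
      (hx.and_eventually (ht.eventually (eventually_eq_flow_add M (half_pos hδ)))).exists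
    have hyx' : y = x + flow z + κ := by rw [add_assoc, ← hyx]; abel
    by_cases hκ0 : κ = 0
    · obtain ⟨z', κ', h1, h2, h3, h4⟩ := hy.2 M (δ / 2) (half_pos hδ)
      refine ⟨z + z', κ', ?_, h2, ?_, h4⟩
      · rw [hyx', hκ0, add_zero] at h1
        rwa [map_add, ← add_assoc]
      · linarith [norm_add_le z z']
    · exact ⟨z, κ, hyx' ▸ hy.1, hκ, by linarith, hκ0⟩

theorem isInv_transverse (ε : ℝ) : IsInv 1 1 (transverse ε) := by
  intro r s hr hs x hx
  refine ⟨isInv_avoiding ε r s hr hs x hx.1, fun M δ hδ => ?_⟩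
  obtain ⟨z, κ, h1, h2, h3, h4⟩ := hx.2 (M + r + s) δ hδ
  refine ⟨rotMul r s * z, shift r s κ, ?_, fun g => ?_, ?_, ?_⟩
  · rw [← shift_flow, ← map_add, ← map_add]
    exact isInv_avoiding ε r s hr hs _ h1
  · rw [shift_val]
    exact eq_zero_of_le h2 (by omega) (by omega) _
  · rwa [norm_mul, norm_rotMul, one_mul]
  · exact shift_ne_zero (eq_zero_of_le h2 (Nat.zero_le _) (Nat.zero_le _)) h4 r s

/-- Near a preperiodic point, the spreading of small characters produces a value close to `0`. -/
theorem transverse_eq_empty {ε : ℝ} (hε : 0 < ε) : transverse ε = ∅ := by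
  by_contra hne
  obtain ⟨x, hx, hper⟩ := exists_isPreperiodic hε (isClosed_transverse ε)
    (Set.nonempty_iff_ne_empty.2 hne) (isInv_transverse ε) fun x hx => hx.1
  obtain ⟨u, u', c, τ, a, b, ha, hb, hxc, hτa, hτb⟩ := hper.exists_shift_eq
  have hx' := isInv_transverse ε u u' (one_dvd _) (one_dvd _) x hx
  rw [hxc] at hx'
  have hc : 0 < ‖c‖ + 3 := by positivity
  obtain ⟨δ, hδ, hδε⟩ : ∃ δ : ℝ, 0 < δ ∧ δ * (‖c‖ + 3) = ε :=
    ⟨ε / (‖c‖ + 3), by positivity, by field_simp⟩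
  obtain ⟨M, hM⟩ := spread ha hb 0 hδ
  obtain ⟨z, κ, hy, hκ, hz, hκ0⟩ := hx'.2 M δ hδ
  obtain ⟨r, s, hr, hs, hrs, w, hw, hval⟩ := hM κ hκ hκ0 (-(flow c + τ))
  have h1 := hy r s
  have h2 : shift r s (flow c + τ + flow z + κ) =
      (flow c + τ) + flow ((rotMul r s - 1) * c + rotMul r s * z) + shift r s κ := by
    rw [map_add, map_add, map_add, shift_flow, shift_flow, shift_mul_eq_self hτa hτb hr hs,
      map_add flow, sub_mul, map_sub, one_mul]
    abel
  have h3 := shift_val_mult r s 0 0 (flow c + τ + flow z + κ)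
  rw [h2, add_zero, add_zero, pow_zero, pow_zero, mul_one, add_val _ (shift r s κ), hval, add_val,
    neg_val, add_add_add_comm, add_neg_cancel, zero_add, flow_val, ← AddCircle.coe_add,
    ← add_re] at h3
  rw [← h3] at h1
  have h4 : ‖((rotMul r s - 1) * c + rotMul r s * z) * toComplex 1 /
      (toComplex π₅ ^ 0 * toComplex π₁₃ ^ 0) + w * toComplex 1‖ < ε := by
    rw [pow_zero, pow_zero, mul_one, div_one, toComplex_one, mul_one, mul_one]
    have h5 : ‖(rotMul r s - 1) * c‖ ≤ δ * ‖c‖ := by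
      rw [norm_mul]; gcongr
    have h6 : ‖rotMul r s * z‖ < δ := by rwa [norm_mul, norm_rotMul, one_mul]
    have h7 := norm_add_le ((rotMul r s - 1) * c) (rotMul r s * z)
    have h8 := norm_add_le ((rotMul r s - 1) * c + rotMul r s * z) w
    linarith
  exact absurd ((h1.trans (norm_coe_le_abs _)).trans (abs_re_le_norm _)) (not_le.2 h4)

/-- The avoiding characters lie on finitely many cosets of the group of real characters. -/
theorem exists_finite_cosets {ε : ℝ} (hε : 0 < ε) :
    ∃ t : Finset Sol, ∀ y ∈ avoiding ε, ∃ x ∈ t, ∃ z : ℂ, y = x + flow z := by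
  have hloc : ∀ x ∈ avoiding ε, ∃ U ∈ 𝓝 x, ∀ y ∈ U, y ∈ avoiding ε → ∃ z : ℂ, y = x + flow z := by
    intro x hx
    have h1 : x ∉ transverse ε := by rw [transverse_eq_empty hε]; exact Set.notMem_empty x
    have h2 : ∃ (M : ℕ) (δ : ℝ), 0 < δ ∧ ∀ (z : ℂ) (κ : Sol), x + flow z + κ ∈ avoiding ε →
        (∀ g, κ.1 g M M = 0) → ‖z‖ < δ → κ = 0 := by
      by_contra! hcon
      exact h1 ⟨hx, hcon⟩
    obtain ⟨M, δ, hδ, h3⟩ := h2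
    have ht : Tendsto (fun y : Sol => y - x) (𝓝 x) (𝓝 0) := by
      have h1 : Continuous fun y : Sol => y - x := continuous_sub_right x
      simpa using h1.tendsto x
    refine ⟨_, ht.eventually (eventually_eq_flow_add M hδ), fun y hy hya => ?_⟩
    obtain ⟨z, κ, hyx, hκ, hz⟩ := hy
    have hyx' : y = x + flow z + κ := by rw [add_assoc, ← hyx]; abel
    exact ⟨z, by rw [hyx', h3 z κ (hyx' ▸ hya) hκ hz, add_zero]⟩
  choose! U hU hUy using hloc
  obtain ⟨t, ht, hcov⟩ := (isClosed_avoiding ε).isCompact.elim_nhds_subcover U hU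
  refine ⟨t, fun y hy => ?_⟩
  obtain ⟨x, hxt, hyx⟩ := Set.mem_iUnion₂.1 (hcov hy)
  exact ⟨x, hxt, hUy x (ht x hxt) y hyx hy⟩

/-- If two points of the orbit of `x` under `π̄₅ / π₅` lie on the same coset of the real characters,
then a multiple of `x` by an integer, depending only on the two exponents, is a real character. -/
theorem exists_nsmul_eq_flow_of_shift (i j : ℕ) (hij : i < j) : ∃ N : ℕ, N ≠ 0 ∧
    ∀ (x : Sol) (z : ℂ), shift i 0 x - shift j 0 x = flow z → ∃ z', N • x = flow z' := by
  have h5 := π₅_ne_zero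
  have h13 := π₁₃_ne_zero
  set e := star π₅ ^ i * π₅ ^ (j - i) - star π₅ ^ j with he
  have he0 : e ≠ 0 := by
    intro h0
    have h1 : star π₅ ^ j = star π₅ ^ i * star π₅ ^ (j - i) := by
      rw [← pow_add]; congr 1; omega
    rw [he, h1, ← mul_sub, mul_eq_zero, sub_eq_zero] at h0
    rcases h0 with h0 | h0
    · exact pow_ne_zero i (star_ne_zero.2 splitPair_five.ne_zero) h0
    · exact splitPair_five.star_pow_ne (by omega) h0.symm
  refine ⟨e.norm.natAbs, by simpa [GaussianInt.norm_eq_zero] using he0, fun x z hz => ?_⟩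
  refine ⟨z * toComplex (star e * π₅ ^ j), ext fun g k l => ?_⟩
  have hN : ((e.norm.natAbs : ℕ) : GaussianInt) = e * star e := by
    rw [← Zsqrtd.norm_eq_mul_conj, natCast_natAbs_norm]
  have h1 : (e.norm.natAbs • x).1 g k l =
      (shift i 0 x - shift j 0 x).1 (star e * π₅ ^ j * g) k l := by
    rw [nsmul_val, ← Solenoid.hom_apply x.2, ← map_nsmul, Solenoid.hom_apply, nsmul_eq_mul, hN,
      sub_val, shift_val, shift_val]
    have h2 := Solenoid.pow_mul_left x.2 (j - i) (star π₅ ^ i * (star e * π₅ ^ j * g)) (k + i) l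
    have h3 := Solenoid.pow_mul_left x.2 j (e * star e * g) k l
    have h4 : k + i + (j - i) = k + j := by omega
    rw [h4] at h2
    have h6 : e * star e * g = e * (star e * g) := mul_assoc _ _ _
    simp only [pow_zero, mul_one, add_zero]
    rw [← h2, ← h3, ← Solenoid.hom_apply x.2, ← Solenoid.hom_apply x.2, ← Solenoid.hom_apply x.2,
      ← map_sub]
    congr 1
    rw [he]
    ring
  rw [h1, hz, flow_val, flow_val]
  congr 2
  rw [toComplex_mul (star e * π₅ ^ j) g]
  ring

/-- A single positive integer carries all avoiding characters to real characters. -/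
theorem exists_nsmul_eq_flow {ε : ℝ} (hε : 0 < ε) :
    ∃ n : ℕ, 1 ≤ n ∧ ∀ x ∈ avoiding ε, ∃ z : ℂ, n • x = flow z := by
  obtain ⟨t, ht⟩ := exists_finite_cosets hε
  have hN : ∀ i j : ℕ, ∃ N : ℕ, N ≠ 0 ∧ (i < j → ∀ (x : Sol) (z : ℂ),
      shift i 0 x - shift j 0 x = flow z → ∃ z', N • x = flow z') := fun i j => by
    by_cases hij : i < j
    · obtain ⟨N, h1, h2⟩ := exists_nsmul_eq_flow_of_shift i j hij
      exact ⟨N, h1, fun _ => h2⟩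
    · exact ⟨1, one_ne_zero, fun h => absurd h hij⟩
  choose N hN0 hN using hN
  set I := Finset.range (t.card + 1) with hI
  refine ⟨∏ i ∈ I, ∏ j ∈ I, N i j, Nat.one_le_iff_ne_zero.2 ?_, fun x hx => ?_⟩
  · exact Finset.prod_ne_zero_iff.2 fun i _ => Finset.prod_ne_zero_iff.2 fun j _ => hN0 i j
  · have h1 : ∀ i : ℕ, ∃ y ∈ t, ∃ z : ℂ, shift i 0 x = y + flow z := fun i =>
      ht _ (isInv_avoiding ε i 0 (one_dvd _) (one_dvd _) x hx)
    choose y hy z hz using h1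
    have key : ∃ i ∈ I, ∃ j ∈ I, i < j ∧ y i = y j := by
      obtain ⟨i, hi, j, hj, hne, hij⟩ := Finset.exists_ne_map_eq_of_card_lt_of_maps_to
        (s := I) (t := t) (by simp [hI]) (fun i _ => hy i)
      rcases lt_or_gt_of_ne hne with h | h
      · exact ⟨i, hi, j, hj, h, hij⟩
      · exact ⟨j, hj, i, hi, h, hij.symm⟩
    obtain ⟨i, hi, j, hj, hij, hyij⟩ := key
    obtain ⟨z', hz'⟩ := hN i j hij x (z i - z j) (by rw [hz, hz, hyij, map_sub]; abel)
    have hdvd : N i j ∣ ∏ i ∈ I, ∏ j ∈ I, N i j :=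
      (Finset.dvd_prod_of_mem (fun j => N i j) hj).trans
        (Finset.dvd_prod_of_mem (fun i => ∏ j ∈ I, N i j) hi)
    obtain ⟨m, hm⟩ := hdvd
    exact ⟨m • z', by rw [hm, mul_comm, mul_nsmul', hz', map_nsmul]⟩

/-- A real character takes values close to `0`, as some rotate of `z` is nearly imaginary. -/
theorem flow_notMem_avoiding {ε : ℝ} (hε : 0 < ε) (z : ℂ) : flow z ∉ avoiding ε := by
  intro h
  rcases eq_or_ne z 0 with rfl | hz
  · have h1 := h 0 0
    rw [map_zero, zero_val, norm_zero] at h1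
    exact absurd h1 (not_le.2 hε)
  · have hz' : 0 < ‖z‖ := norm_pos_iff.2 hz
    obtain ⟨I, hI⟩ := exists_pow_mul_near_one (η := rot π₅) (norm_rot splitPair_five.ne_zero)
      (fun n hn => rot_pow_ne_one splitPair_five.ne_zero (splitPair_five.star_pow_ne hn))
      (div_pos hε hz')
    obtain ⟨r, -, hr⟩ := hI (-(Complex.I * z / ‖z‖)) (by simp [hz])
    have h1 := h r 0
    rw [flow_val_mult] at h1
    have h2 : (rotMul r 0 * z).re =
        (Complex.I * ‖z‖ * (rot π₅ ^ r * -(Complex.I * z / ‖z‖) - 1)).re := by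
      have h3 : Complex.I * ‖z‖ * (rot π₅ ^ r * -(Complex.I * z / ‖z‖) - 1) =
          rotMul r 0 * z - ((‖z‖ : ℝ) : ℂ) * Complex.I := by
        have h4 : ((‖z‖ : ℝ) : ℂ) ≠ 0 := by exact_mod_cast hz'.ne'
        rw [rotMul, pow_zero, mul_one]
        field_simp
        ring_nf
        rw [Complex.I_sq]
        ring
      rw [h3, sub_re, re_ofReal_mul, I_re, mul_zero, sub_zero]
    rw [h2] at h1
    have h5 := (h1.trans (norm_coe_le_abs _)).trans (abs_re_le_norm _)
    rw [norm_mul, norm_mul, norm_I, one_mul, norm_real, norm_norm] at h5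
    rw [lt_div_iff₀ hz'] at hr
    linarith

/-! ### Covering the plane -/

/-- The characters whose values at the multipliers with exponents up to `N` are at distance at least
`ε` from `0`. -/
def avoidingUpTo (ε : ℝ) (N : ℕ) : Set Sol :=
  {x | ∀ r s, r ≤ N → s ≤ N → ε ≤ ‖x.1 (star π₅ ^ r * star π₁₃ ^ s) r s‖}

theorem isClosed_avoidingUpTo (ε : ℝ) (N : ℕ) : IsClosed (avoidingUpTo ε N) := by
  simp only [avoidingUpTo, Set.ofPred_forall]
  exact isClosed_iInter fun r => isClosed_iInter fun s => isClosed_iInter fun _ =>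
    isClosed_iInter fun _ => isClosed_le continuous_const (continuous_val _ _ _).norm

/-- By compactness, for some `n` and `N` no two characters `x`, `y` and `n (x + y)` all
avoid a neighbourhood of `0` up to exponent `N`. -/
theorem exists_not_avoidingUpTo {ε : ℝ} (hε : 0 < ε) : ∃ n N : ℕ, 1 ≤ n ∧ ∀ x y : Sol,
    x ∈ avoidingUpTo ε N → y ∈ avoidingUpTo ε N → n • (x + y) ∉ avoidingUpTo ε N := by
  obtain ⟨n, hn, hflow⟩ := exists_nsmul_eq_flow hε
  by_contra! hcon
  set C : ℕ → Set (Sol × Sol) := fun N => {t | t.1 ∈ avoidingUpTo ε N ∧ t.2 ∈ avoidingUpTo ε N ∧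
    n • (t.1 + t.2) ∈ avoidingUpTo ε N} with hC
  have hCcl : ∀ N, IsClosed (C N) := fun N => by
    have hcl := isClosed_avoidingUpTo ε N
    exact (hcl.preimage continuous_fst).inter ((hcl.preimage continuous_snd).inter
      (hcl.preimage ((continuous_fst.add continuous_snd).nsmul n)))
  have hanti : ∀ N, avoidingUpTo ε (N + 1) ⊆ avoidingUpTo ε N := fun N x hx r s hr hs =>
    hx r s (by omega) (by omega)
  obtain ⟨⟨x, y⟩, hxy⟩ := IsCompact.nonempty_iInter_of_sequence_nonempty_isCompact_isClosed C
    (fun N t ht => ⟨hanti N ht.1, hanti N ht.2.1, hanti N ht.2.2⟩)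
    (fun N => by
      obtain ⟨x, y, h1, h2, h3⟩ := hcon n N hn
      exact ⟨(x, y), h1, h2, h3⟩) (hCcl 0).isCompact hCcl
  have hmem : ∀ N, (x, y) ∈ C N := Set.mem_iInter.1 hxy
  obtain ⟨z, hz⟩ := hflow x fun r s => (hmem (max r s)).1 r s (le_max_left _ _) (le_max_right _ _)
  obtain ⟨z', hz'⟩ := hflow y fun r s =>
    (hmem (max r s)).2.1 r s (le_max_left _ _) (le_max_right _ _)
  refine flow_notMem_avoiding hε (z + z') ?_
  rw [map_add, ← hz, ← hz', ← nsmul_add]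
  exact fun r s => (hmem (max r s)).2.2 r s (le_max_left _ _) (le_max_right _ _)

end Sol

theorem θ₅_eq : θ₅ = rot π₅ := by
  have h : P₅ = toComplex (star π₅) := by simp [P₅, toComplex_def']
  rw [θ₅, rot, h, ← toComplex_star, star_star]

theorem θ₁₃_eq : θ₁₃ = rot π₁₃ := by
  have h : P₁₃ = toComplex (star π₁₃) := by simp [P₁₃, toComplex_def']
  rw [θ₁₃, rot, h, ← toComplex_star, star_star]

theorem mem_Θ_iff {N : ℕ} {θ : ℂ} : θ ∈ Θ N ↔ ∃ r s, r ≤ N ∧ s ≤ N ∧ θ = rotMul r s := by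
  rw [Θ, θ₅_eq, θ₁₃_eq]
  rfl

theorem le_norm_of_notMem_rotatedStripe {ε : ℝ} {θ z : ℂ} (hθ : θ ≠ 0)
    (h : z ∉ rotatedStripe ε θ) : ε ≤ ‖((θ * z).re : UnitAddCircle)‖ := by
  by_contra! hlt
  rw [UnitAddCircle.norm_eq] at hlt
  exact h ⟨θ * z, ⟨round (θ * z).re, hlt⟩, inv_mul_cancel_left₀ hθ z⟩

theorem flow_mem_avoidingUpTo {ε : ℝ} {N : ℕ} {ζ z : ℂ} (hζ : ‖ζ‖ = 1)
    (h : ∀ θ ∈ Θ N, z ∉ rotatedStripe ε (ζ * θ)) : Sol.flow (ζ * z) ∈ Sol.avoidingUpTo ε N := by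
  intro r s hr hs
  have h1 : ‖ζ * rotMul r s‖ = 1 := by rw [norm_mul, hζ, norm_rotMul, one_mul]
  have h2 := le_norm_of_notMem_rotatedStripe (norm_ne_zero_iff.1 (h1.symm ▸ one_ne_zero))
    (h _ (mem_Θ_iff.2 ⟨r, s, hr, hs, rfl⟩))
  rwa [Sol.flow_val_mult, ← mul_assoc, mul_comm (rotMul r s)]

theorem exists_isTriple {n : ℕ} (hn : 1 ≤ n) : ∃ ζ₁ ζ₂ ζ₃ : ℂ, IsTriple n ζ₁ ζ₂ ζ₃ := by
  have hn' : (1 : ℝ) ≤ n := by exact_mod_cast hn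
  set t : ℝ := 1 / (2 * n) with ht
  have ht1 : t ^ 2 ≤ 1 := by
    have h1 : t ≤ 1 := by rw [ht, div_le_one (by positivity)]; linarith
    have h0 : 0 ≤ t := by positivity
    nlinarith
  have hsq := Real.sq_sqrt (sub_nonneg.2 ht1)
  have hnorm : ∀ u : ℝ, u ^ 2 = 1 - t ^ 2 → ‖(⟨t, u⟩ : ℂ)‖ = 1 := fun u hu => by
    rw [Complex.norm_def, Complex.normSq_mk, ← pow_two, ← pow_two, hu]
    simp
  refine ⟨⟨t, √(1 - t ^ 2)⟩, ⟨t, -√(1 - t ^ 2)⟩, 1, hnorm _ hsq, hnorm _ (by rw [neg_sq, hsq]),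
    norm_one, ?_⟩
  have h1 : (⟨t, √(1 - t ^ 2)⟩ + ⟨t, -√(1 - t ^ 2)⟩ : ℂ) = ((2 * t : ℝ) : ℂ) := by
    apply Complex.ext <;> simp [two_mul]
  have h2 : (n : ℝ) * (2 * t) = 1 := by
    rw [ht]; field_simp
  rw [h1]
  exact_mod_cast h2

theorem finite_Θ (N : ℕ) : (Θ N).Finite := by
  refine (((Set.finite_Iic N).prod (Set.finite_Iic N)).image fun t => rotMul t.1 t.2).subset ?_
  intro θ hθ
  obtain ⟨r, s, hr, hs, rfl⟩ := mem_Θ_iff.1 hθ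
  exact ⟨(r, s), ⟨hr, hs⟩, rfl⟩

theorem norm_of_mem_Θ' {N n : ℕ} {ζ₁ ζ₂ ζ₃ : ℂ} (h : IsTriple n ζ₁ ζ₂ ζ₃) {φ : ℂ}
    (hφ : φ ∈ Θ' N ζ₁ ζ₂ ζ₃) : ‖φ‖ = 1 := by
  obtain ⟨h1, h2, h3, -⟩ := h
  have key : ∀ ζ : ℂ, ‖ζ‖ = 1 → φ ∈ (fun θ : ℂ => ζ * θ) '' Θ N → ‖φ‖ = 1 := by
    rintro ζ hζ ⟨θ, hθ, rfl⟩
    obtain ⟨r, s, -, -, rfl⟩ := mem_Θ_iff.1 hθ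
    simp [hζ, norm_rotMul]
  rcases hφ with (hφ | hφ) | hφ
  · exact key _ h1 hφ
  · exact key _ h2 hφ
  · exact key _ h3 hφ

theorem exists_iUnion_rotatedStripe_eq_univ {ε : ℝ} (hε : 0 < ε) :
    ∃ n N : ℕ, 1 ≤ n ∧ ∀ ζ₁ ζ₂ ζ₃ : ℂ, IsTriple n ζ₁ ζ₂ ζ₃ →
      (⋃ θ ∈ Θ' N ζ₁ ζ₂ ζ₃, rotatedStripe ε θ) = Set.univ := by
  obtain ⟨n, N, hn, h⟩ := Sol.exists_not_avoidingUpTo hε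
  refine ⟨n, N, hn, fun ζ₁ ζ₂ ζ₃ ⟨h1, h2, h3, hsum⟩ => ?_⟩
  by_contra hne
  obtain ⟨z, hz⟩ := (Set.ne_univ_iff_exists_notMem _).1 hne
  have hz' : ∀ θ ∈ Θ' N ζ₁ ζ₂ ζ₃, z ∉ rotatedStripe ε θ := fun θ hθ hzθ =>
    hz (Set.mem_iUnion₂.2 ⟨θ, hθ, hzθ⟩)
  refine h (Sol.flow (ζ₁ * z)) (Sol.flow (ζ₂ * z))
    (flow_mem_avoidingUpTo h1 fun θ hθ => hz' _ (Or.inl (Or.inl ⟨θ, hθ, rfl⟩)))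
    (flow_mem_avoidingUpTo h2 fun θ hθ => hz' _ (Or.inl (Or.inr ⟨θ, hθ, rfl⟩))) ?_
  have h4 : n • (Sol.flow (ζ₁ * z) + Sol.flow (ζ₂ * z)) = Sol.flow (ζ₃ * z) := by
    rw [← map_add, ← map_nsmul, ← hsum, nsmul_eq_mul]
    congr 1
    ring
  rw [h4]
  exact flow_mem_avoidingUpTo h3 fun θ hθ => hz' _ (Or.inr ⟨θ, hθ, rfl⟩)

end Pyjama

theorem mainTheorem1 :
    (∀ n : ℕ, 1 ≤ n → ∃ ζ₁ ζ₂ ζ₃ : ℂ, Pyjama.IsTriple n ζ₁ ζ₂ ζ₃) ∧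
    (∀ ε : ℝ, 0 < ε →
      (∃ n N : ℕ, 1 ≤ n ∧ ∀ ζ₁ ζ₂ ζ₃ : ℂ, Pyjama.IsTriple n ζ₁ ζ₂ ζ₃ →
        (⋃ θ ∈ Pyjama.Θ' N ζ₁ ζ₂ ζ₃, Pyjama.rotatedStripe ε θ) = Set.univ) ∧
      (∃ Φ : Set ℂ, Φ.Finite ∧ (∀ φ ∈ Φ, ‖φ‖ = 1) ∧
        (⋃ φ ∈ Φ, Pyjama.rotatedStripe ε φ) = Set.univ)) := by
  refine ⟨fun n hn => Pyjama.exists_isTriple hn, fun ε hε =>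
    ⟨Pyjama.exists_iUnion_rotatedStripe_eq_univ hε, ?_⟩⟩
  obtain ⟨n, N, hn, h⟩ := Pyjama.exists_iUnion_rotatedStripe_eq_univ hε
  obtain ⟨ζ₁, ζ₂, ζ₃, hζ⟩ := Pyjama.exists_isTriple hn
  have hfin := Pyjama.finite_Θ N
  exact ⟨Pyjama.Θ' N ζ₁ ζ₂ ζ₃, ((hfin.image _).union (hfin.image _)).union (hfin.image _),
    fun φ hφ => Pyjama.norm_of_mem_Θ' hζ hφ, h ζ₁ ζ₂ ζ₃ hζ⟩
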